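/- **Theorem (Variable Target Dual Mirror Descent guarantee).** *Setting.* Let $m\ge 1$. A request $\gamma=(f,b,\mathcal X)$ consists of a compact action set $\mathcal X\subset\mathbb R_+^d$ with $0\in\mathcal X$, a reward function $f:\mathcal X\to\mathbb R_+$ and a consumption function $b:\mathcal X\to\mathbb R_+^m$ with $b(0)=0$. Let $\mathcal P$ be a probability distribution on a set $\mathcal S$ of requests such that, for constants $\bar f,\bar b\ge 0$, $|f(x)|\le\bar f$ and $\|b(x)\|_\infty\le\bar b$ for every $(f,b,\mathcal X)\in\mathcal S$ and $x\in\mathcal X$. The budget $B\in\mathbb R_{++}^m$ satisfies $B_j\ge 2\bar b$ for all $j$. For $T\ge 1$ put $\rho_T=B/T$ and $\underline\rho_T=\min_j\rho_{T,j}$, and let $\vec\gamma=(\gamma_1,\dots,\gamma_T)\sim\mathcal P^T$. The hindsight optimum is $$\mathrm{OPT}(T,\vec\gamma)=\sup\Big\{\sum_{t=1}^T f_t(x_t):\ x_t\in\mathcal X_t,\ \sum_{t=1}^T b_t(x_t)\le B\Big\}.$$ A target consumption sequence is $\vec\lambda=(\lambda_1,\dots,\lambda_{\tau_2})$ with $\lambda_t\in\mathbb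 R_+^m$ and $\sum_{t=1}^{\tau_2}\lambda_t\le B$; let $\bar\lambda=\max_{t\le\tau_2,\,j}\lambda_{t,j}$ and $$c(\vec\lambda,T)=\frac1T\sum_{t=1}^T\min\Big\{\min_{1\le j\le m}\frac{\lambda_{t,j}}{\rho_{T,j}},\,1\Big\}.$$ The reference function $h:\mathbb R_+^m\to\mathbb R$ is differentiable or essentially smooth on $\mathbb R_+^m$ (it is differentiable at all points with positive coordinates, and at each boundary point it is either differentiable relative to $\mathbb R_+^m$ or its gradient norm tends to infinity there), and it is $\sigma$-strongly convex ($\sigma>0$) with respect to $\|\cdot\|_1$, i.e. $h(x)\ge h(y)+\nabla h(y)^\top(x-y)+\frac\sigma2\|x-y\|_1^2$ for all $x,y\in\mathbb R_+^m$ with $h$ differentiable at $y$. Its Bregman divergence is $V_h(x,y)=h(x)-h(y)-\nabla h(y)^\top(x-y)$. *Algorithm $A$* (input: $B_1=B$, $\vec\lambda$, $h$, step size $\eta>0$, initial dual variable $\mu_1\in\mathbb R_+^m$ at which $h$ is differentiable). At each time $t=1,2,\dots$ it observes $\gamma_t=(f_t,b_t,\mathcal X_t)$ and 1. picks $\tilde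 x_t\in\arg\max_{x\in\mathcal X_t}\{f_t(x)-\mu_t^\top b_t(x)\}$; 2. plays $x_t=\tilde x_t$ if $b_t(\tilde x_t)\le B_t$ and $x_t=0$ otherwise, and sets $B_{t+1}=B_t-b_t(x_t)$; 3. sets $g_t=\lambda_t-b_t(\tilde x_t)$ and $\mu_{t+1}=\arg\min_{\mu\in\mathbb R_+^m}\{g_t^\top\mu+\frac1\eta V_h(\mu,\mu_t)\}$. Its reward is $R(A|T,\vec\gamma)=\sum_{t=1}^T f_t(x_t)$. The maximizers $\tilde x_t=\tilde x(\gamma_t,\mu_t)$ are assumed to exist and to be chosen so that $f(\tilde x(\gamma,\mu))$ and $b(\tilde x(\gamma,\mu))$ are measurable in $(\gamma,\mu)$; $f(0)$ and $\mathrm{OPT}(T,\cdot)$ are assumed measurable. *Claim.* For every target consumption sequence $\vec\lambda$ and every horizon $1\le T\le\tau_2$, the random variable below is integrable and $$\mathbb E_{\vec\gamma\sim\mathcal P^T}\big[c(\vec\lambda,T)\,\mathrm{OPT}(T,\vec\gamma)-R(A|T,\vec\gamma)\big]\ \le\ \frac{\bar f\,\bar b}{\underline\rho_T}+\frac{(\bar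 b+\bar\lambda)^2}{2\sigma}\,\eta\,T+\frac1\eta\max\Big\{V_h(\mu,\mu_1):\ \mu\in\big\{0,\tfrac{\bar f}{\underline\rho_T}e_1,\dots,\tfrac{\bar f}{\underline\rho_T}e_m\big\}\Big\}.$$ The same bound holds for the variant of the algorithm that uses $g_t=\lambda_t-b_t(x_t)$ in step 3. -/

import Mathlib

open MeasureTheory Filter Topology

noncomputable section

namespace HorizonAlloc

/-- A request `γ = (f, b, 𝒳)` with `m` resources and action set in `ℝ^d`. -/
structure Request (d m : ℕ) where
  /-- the action set `𝒳` -/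
  actions : Set (Fin d → ℝ)
  isCompact_actions : IsCompact actions
  actions_nonneg : ∀ x ∈ actions, 0 ≤ x
  zero_mem : (0 : Fin d → ℝ) ∈ actions
  /-- the reward function `f : 𝒳 → ℝ₊` -/
  reward : actions → ℝ
  reward_nonneg : ∀ x, 0 ≤ reward x
  /-- the resource consumption function `b : 𝒳 → ℝ₊^m` -/
  consumption : actions → (Fin m → ℝ)
  consumption_nonneg : ∀ x, 0 ≤ consumption x
  consumption_zero : consumption ⟨0, zero_mem⟩ = 0

/-- The void action `0 ∈ 𝒳`. -/
def Request.void {d m : ℕ} (γ : Request d m) : γ.actions := ⟨0, γ.zero_mem⟩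

/-- The hindsight-optimal reward `OPT(T, γ⃗)`: the optimal value of
`∑ t, f_t (x_t)` over all `x ∈ ∏ t, 𝒳_t` with `∑ t, b_t (x_t) ≤ B` (componentwise). -/
def opt {d m : ℕ} {S : Set (Request d m)} (B : Fin m → ℝ) {T : ℕ} (γ : Fin T → S) : ℝ :=
  sSup {r : ℝ | ∃ x : (t : Fin T) → (γ t).1.actions,
    ∑ t, (γ t).1.consumption (x t) ≤ B ∧ r = ∑ t, (γ t).1.reward (x t)}

/-- The per-period resource endowment `ρ_T = B / T`. -/
def rho {m : ℕ} (B : Fin m → ℝ) (T : ℕ) (j : Fin m) : ℝ := B j / T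

/-- `min_j ρ_{T,j}`. -/
def rhoMin {m : ℕ} (B : Fin m → ℝ) (T : ℕ) : ℝ := ⨅ j, rho B T j

/-- `c(λ, T) = (1/T) ∑_{t ≤ T} min {min_j λ_{t,j} / ρ_{T,j}, 1}`.
Time is indexed from `0`, so `lam t` is the target of the `(t+1)`-st period. -/
def targetRatio {m : ℕ} (B : Fin m → ℝ) (lam : ℕ → Fin m → ℝ) (T : ℕ) : ℝ :=
  (1 / (T : ℝ)) * ∑ t ∈ Finset.range T, min (⨅ j, lam t j / rho B T j) 1

/-- `lam 0, …, lam (N - 1)` is a target consumption sequence for the budget `B`. -/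
structure IsTargetSequence {m : ℕ} (B : Fin m → ℝ) (N : ℕ) (lam : ℕ → Fin m → ℝ) : Prop where
  nonneg : ∀ t < N, 0 ≤ lam t
  sum_le : ∑ t ∈ Finset.range N, lam t ≤ B

/-- The largest target consumption `max_{t, j} λ_{t,j}` of a sequence of length `N`. -/
def targetMax {m : ℕ} (N : ℕ) (lam : ℕ → Fin m → ℝ) : ℝ := ⨆ t : Fin N, ⨆ j, lam t j

/-- The nonnegative orthant `ℝ₊^m`. -/
def orthant (m : ℕ) : Set (Fin m → ℝ) := {μ | 0 ≤ μ}

/-- The Bregman divergence `V_h(x, y) = h(x) - h(y) - ∇h(y)ᵀ(x - y)` on `ℝ₊^m`.  At boundary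
points the gradient is the one relative to `ℝ₊^m`. -/
def bregman {m : ℕ} (h : (Fin m → ℝ) → ℝ) (x y : Fin m → ℝ) : ℝ :=
  h x - h y - fderivWithin ℝ h (orthant m) y (x - y)

/-- `h` is a reference function on `ℝ₊^m` with parameter `σ`: it is differentiable or essentially
smooth on `ℝ₊^m`, i.e. it is differentiable at every point with positive coordinates, and at every
point of `ℝ₊^m` where it is not differentiable the norm of its gradient blows up; and it is
`σ`-strongly convex with respect to the `ℓ¹` norm. -/
structure IsReferenceFunction {m : ℕ} (h : (Fin m → ℝ) → ℝ) (σ : ℝ) : Prop where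
  differentiableWithinAt : ∀ y : Fin m → ℝ, (∀ j, 0 < y j) →
    DifferentiableWithinAt ℝ h (orthant m) y
  differentiable_or_blowup : ∀ y ∈ orthant m,
    DifferentiableWithinAt ℝ h (orthant m) y ∨
      Tendsto (fun z => ‖fderivWithin ℝ h (orthant m) z‖) (𝓝[{z | ∀ j, 0 < z j}] y) atTop
  strongConvex : ∀ x ∈ orthant m, ∀ y ∈ orthant m, DifferentiableWithinAt ℝ h (orthant m) y →
    h y + fderivWithin ℝ h (orthant m) y (x - y) + σ / 2 * (∑ j, |x j - y j|) ^ 2 ≤ h x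

/-- The mirror descent update
`argmin_{ν ∈ ℝ₊^m} { gᵀν + (1/η) V_h(ν, μ) }`. -/
def mirrorStep {m : ℕ} (h : (Fin m → ℝ) → ℝ) (η : ℝ) (g μ : Fin m → ℝ) : Fin m → ℝ :=
  Classical.epsilon fun ν => ν ∈ orthant m ∧
    IsMinOn (fun ν' => g ⬝ᵥ ν' + (1 / η) * bregman h ν' μ) (orthant m) ν

/-- Which action enters the subgradient `g_t = λ_t - b_t(·)`: the price-adjusted maximizer `x̃_t`
(`proposed`), or the action `x_t` taken after the feasibility check (`implemented`). -/
inductive GradientRule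
  | proposed
  | implemented

/-- The input of Variable Target Dual Mirror Descent; `oracle γ μ` is the element of
`argmax_{x ∈ 𝒳} { f(x) - μᵀ b(x) }` that the algorithm picks. -/
structure AlgInput {d m : ℕ} (S : Set (Request d m)) where
  budget : Fin m → ℝ
  target : ℕ → Fin m → ℝ
  refFun : (Fin m → ℝ) → ℝ
  stepSize : ℝ
  initDual : Fin m → ℝ
  oracle : (γ : S) → (Fin m → ℝ) → γ.1.actions
  gradientRule : GradientRule

/-- The algorithm's state at the beginning of a period: dual variable and remaining resources. -/
structure AlgState (m : ℕ) where
  dual : Fin m → ℝ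
  remaining : Fin m → ℝ

section Algorithm

variable {d m : ℕ} {S : Set (Request d m)}

open Classical in
/-- The action `x_t`: `x̃_t` if `b_t(x̃_t) ≤ B_t`, and `0` otherwise. -/
def AlgInput.action (A : AlgInput S) (s : AlgState m) (γ : S) : γ.1.actions :=
  if γ.1.consumption (A.oracle γ s.dual) ≤ s.remaining then A.oracle γ s.dual else γ.1.void

/-- The consumption that enters the subgradient. -/
def AlgInput.gradientConsumption (A : AlgInput S) (s : AlgState m) (γ : S) : Fin m → ℝ :=
  match A.gradientRule with
  | .proposed => γ.1.consumption (A.oracle γ s.dual)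
  | .implemented => γ.1.consumption (A.action s γ)

/-- One period with target `lamt` and request `γ`: `B_{t+1} = B_t - b_t(x_t)`, and `μ_{t+1}` is the
mirror descent update of `μ_t` with subgradient `g_t = λ_t - b_t`. -/
def AlgInput.step (A : AlgInput S) (lamt : Fin m → ℝ) (s : AlgState m) (γ : S) : AlgState m where
  dual := mirrorStep A.refFun A.stepSize (lamt - A.gradientConsumption s γ) s.dual
  remaining := s.remaining - γ.1.consumption (A.action s γ)

/-- The state after the first `n` requests have been processed. -/
def AlgInput.state (A : AlgInput S) : (n : ℕ) → (Fin n → S) → AlgState m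
  | 0, _ => ⟨A.initDual, A.budget⟩
  | n + 1, γ => A.step (A.target n) (A.state n (Fin.init γ)) (γ (Fin.last n))

/-- The state in which the algorithm meets the request `γ t`; it depends only on the requests
before `t`. -/
def AlgInput.stateAt (A : AlgInput S) {T : ℕ} (γ : Fin T → S) (t : Fin T) : AlgState m :=
  A.state t fun i => γ (Fin.castLE t.isLt.le i)

/-- The total reward `R(A | T, γ⃗) = ∑ t, f_t(x_t)`. -/
def AlgInput.totalReward (A : AlgInput S) {T : ℕ} (γ : Fin T → S) : ℝ :=
  ∑ t, (γ t).1.reward (A.action (A.stateAt γ t) (γ t))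

/-- `oracle γ μ` maximizes `f(x) - μᵀ b(x)` over `𝒳`, for every request and every `μ ∈ ℝ₊^m`, and
the resulting reward and consumption are measurable in `(γ, μ)`. -/
structure IsBestResponse [MeasurableSpace S]
    (oracle : (γ : S) → (Fin m → ℝ) → γ.1.actions) : Prop where
  isMax : ∀ (γ : S), ∀ μ ∈ orthant m, ∀ x : γ.1.actions,
    γ.1.reward x - μ ⬝ᵥ γ.1.consumption x ≤
      γ.1.reward (oracle γ μ) - μ ⬝ᵥ γ.1.consumption (oracle γ μ)
  measurable_reward :
    Measurable fun p : S × orthant m => p.1.1.reward (oracle p.1 p.2.1)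
  measurable_consumption :
    Measurable fun p : S × orthant m => p.1.1.consumption (oracle p.1 p.2.1)

end Algorithm

end HorizonAlloc

end

open HorizonAlloc

/-!
The proof combines a pathwise regret bound for mirror descent with Lagrangian duality.

*The mirror step.* The reference function `h` is only known to be strongly convex at its points of
differentiability and may fail to be lower semicontinuous on the boundary of the orthant, so the
existence of the update has to be proved. Minimizing sequences of `θᵀν + h(ν)` are bounded by strong
convexity, and the blow-up of the gradient forces their limits to be points of differentiability
(`IsReferenceFunction.mem_smoothPoints_of_tendsto_min`), where `h` is continuous. Hence minimizers
exist, are points of differentiability, and depend on `θ` in a Lipschitz way. The update is the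
minimizer for `θ = η g - ∇h(μ)` (`IsReferenceFunction.mirrorStep_eq`), so it satisfies the usual
one-step regret inequality (`IsReferenceFunction.mirrorStep_regret`), and it is measurable because
`∇h` is, as a limit of difference quotients.

*The path.* Call the resources ample while at least `b̄` of each of them is left; then `x_t = x̃_t`,
and the two gradient rules agree. Ampleness at time `t` depends on the past only, and once lost it
is not regained. Let `F(μ) = 𝔼 [max_x {f(x) - μᵀ b(x)}]` and let `O` be the expected optimum per
period. Relaxing the budget constraint gives `O ≤ F(μ) + μᵀ ρ` for `μ ≥ 0`, hence
`c_t O ≤ F(μ) + μᵀ λ_t`, where `c_t` is the `t`-th term of the target ratio. Summing `F(μ_t) + μ_tᵀ b_t`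
over the ample periods and applying the regret bound gives the guarantee for these periods, up to
`uᵀ ∑ (λ_t - b_t)` for a comparator `u`. If resources stay ample, take `u = 0`. Otherwise some resource
`j` is used up to less than `b̄`; with `u = (f̄ / ρ_min) e_j` the sum is at most `f̄ b̄ / ρ_min`
minus `(f̄ / ρ_min) λ_{t,j}` for each later period, which covers the reward `c_t O ≤ c_t f̄` lost in it
(`AlgInput.ample_or_credit_ge`, `AlgInput.credit_ge`).

*The expectation.* Rewards in ample periods differ from `F(μ_t) + μ_tᵀ b_t` by
`F(μ_t) - max_x {f_t(x) - μ_tᵀ b_t(x)}`, which is bounded and has mean zero because `γ_t` is independent of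
`μ_t` (`AlgInput.integral_noise_stateAt`). Only bounded variables are integrated.
-/

namespace HorizonAlloc

/-! ### Sup norm and `ℓ¹` norm -/

theorem dotProduct_le_mul_sum_abs {m : ℕ} {M : ℝ} (a b : Fin m → ℝ) (ha : ∀ j, |a j| ≤ M) :
    a ⬝ᵥ b ≤ M * ∑ j, |b j| := by
  rw [dotProduct, Finset.mul_sum]
  refine Finset.sum_le_sum fun j _ => (le_abs_self _).trans ?_
  rw [abs_mul]
  exact mul_le_mul_of_nonneg_right (ha j) (abs_nonneg _)

theorem norm_le_sum_abs {m : ℕ} (x : Fin m → ℝ) : ‖x‖ ≤ ∑ j, |x j| :=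
  (pi_norm_le_iff_of_nonneg (Finset.sum_nonneg fun _ _ => abs_nonneg _)).2 fun j =>
    Finset.single_le_sum (f := fun j => |x j|) (fun _ _ => abs_nonneg _) (Finset.mem_univ j)

/-! ### Reference functions on the orthant -/

theorem isClosed_orthant (m : ℕ) : IsClosed (orthant m) := isClosed_Ici

theorem convex_orthant (m : ℕ) : Convex ℝ (orthant m) := convex_Ici 0

/-- The points of the orthant at which `h` is differentiable relative to the orthant. -/
def smoothPoints {m : ℕ} (h : (Fin m → ℝ) → ℝ) : Set (Fin m → ℝ) :=
  {μ | μ ∈ orthant m ∧ DifferentiableWithinAt ℝ h (orthant m) μ}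

/-- The gradient of `h` relative to the orthant, as a vector; a junk value outside
`smoothPoints h`. -/
noncomputable def gradWithin {m : ℕ} (h : (Fin m → ℝ) → ℝ) (y : Fin m → ℝ) : Fin m → ℝ :=
  fun j => fderivWithin ℝ h (orthant m) y (Pi.single j 1)

theorem fderivWithin_eq_gradWithin_dotProduct {m : ℕ} (h : (Fin m → ℝ) → ℝ) (y v : Fin m → ℝ) :
    fderivWithin ℝ h (orthant m) y v = gradWithin h y ⬝ᵥ v := by
  have := LinearMap.pi_apply_eq_sum_univ (fderivWithin ℝ h (orthant m) y).toLinearMap v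
  simp only [ContinuousLinearMap.coe_coe, smul_eq_mul] at this
  rw [this, dotProduct]
  refine Finset.sum_congr rfl fun j _ => ?_
  rw [mul_comm, gradWithin]
  congr 2
  ext i
  simp [Pi.single_apply, eq_comm]

theorem norm_fderivWithin_le_sum_abs {m : ℕ} (h : (Fin m → ℝ) → ℝ) (y : Fin m → ℝ) :
    ‖fderivWithin ℝ h (orthant m) y‖ ≤ ∑ j, |gradWithin h y j| := by
  refine ContinuousLinearMap.opNorm_le_bound _ (Finset.sum_nonneg fun _ _ => abs_nonneg _) fun v => ?_
  rw [fderivWithin_eq_gradWithin_dotProduct, Real.norm_eq_abs, dotProduct, Finset.sum_mul]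
  refine (Finset.abs_sum_le_sum_abs _ _).trans (Finset.sum_le_sum fun j _ => ?_)
  rw [abs_mul]
  exact mul_le_mul_of_nonneg_left (norm_le_pi_norm v j) (abs_nonneg _)

theorem bregman_eq {m : ℕ} (h : (Fin m → ℝ) → ℝ) (x y : Fin m → ℝ) :
    bregman h x y = h x - h y - gradWithin h y ⬝ᵥ (x - y) := by
  rw [bregman, fderivWithin_eq_gradWithin_dotProduct]

/-- A vector minimizing `θᵀν + h(ν)` over the orthant. -/
noncomputable def linArgmin {m : ℕ} (h : (Fin m → ℝ) → ℝ) (θ : Fin m → ℝ) : Fin m → ℝ :=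
  Classical.epsilon fun ν => ν ∈ orthant m ∧ IsMinOn (fun x => θ ⬝ᵥ x + h x) (orthant m) ν

namespace IsReferenceFunction

variable {m : ℕ} {h : (Fin m → ℝ) → ℝ} {σ : ℝ}

theorem mem_smoothPoints_of_pos (hh : IsReferenceFunction h σ) {y : Fin m → ℝ} (hy : ∀ j, 0 < y j) :
    y ∈ smoothPoints h :=
  ⟨fun j => (hy j).le, hh.differentiableWithinAt y hy⟩

theorem tangent_le (hh : IsReferenceFunction h σ) {x y : Fin m → ℝ} (hx : x ∈ orthant m)
    (hy : y ∈ smoothPoints h) :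
    h y + gradWithin h y ⬝ᵥ (x - y) + σ / 2 * (∑ j, |x j - y j|) ^ 2 ≤ h x := by
  have := hh.strongConvex x hx y hy.1 hy.2
  rwa [fderivWithin_eq_gradWithin_dotProduct] at this

theorem tangent_le' (hh : IsReferenceFunction h σ) (hσ : 0 < σ) {x y : Fin m → ℝ}
    (hx : x ∈ orthant m) (hy : y ∈ smoothPoints h) :
    h y + gradWithin h y ⬝ᵥ (x - y) ≤ h x := by
  have := hh.tangent_le hx hy
  have : 0 ≤ σ / 2 * (∑ j, |x j - y j|) ^ 2 := by positivity
  linarith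

theorem bregman_ge (hh : IsReferenceFunction h σ) {x y : Fin m → ℝ} (hx : x ∈ orthant m)
    (hy : y ∈ smoothPoints h) : σ / 2 * (∑ j, |x j - y j|) ^ 2 ≤ bregman h x y := by
  have := hh.tangent_le hx hy
  rw [bregman_eq]
  linarith

theorem bregman_nonneg (hh : IsReferenceFunction h σ) (hσ : 0 < σ) {x y : Fin m → ℝ}
    (hx : x ∈ orthant m) (hy : y ∈ smoothPoints h) : 0 ≤ bregman h x y :=
  le_trans (by positivity) (hh.bregman_ge hx hy)

/-- A limit of a minimizing sequence of `θᵀν + h(ν)` is a point of differentiability.  Here `h` need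
not be lower semicontinuous, so the limit is not assumed to be a minimizer. If the gradient blew up
at the limit `y`, it would be unbounded on the ray `z = y + t𝟙`; but there the
partial derivatives of the objective are bounded above by convexity, and their sum is nonnegative
since moving from `z` towards `y` cannot increase the objective to first order. -/
theorem mem_smoothPoints_of_tendsto_min (hh : IsReferenceFunction h σ) (hσ : 0 < σ)
    (θ : Fin m → ℝ) {y : Fin m → ℝ} (hy : y ∈ orthant m) {I : ℝ} {ν : ℕ → Fin m → ℝ}
    (hν : ∀ k, ν k ∈ orthant m) (hνy : Tendsto ν atTop (𝓝 y))
    (hνI : Tendsto (fun k => θ ⬝ᵥ ν k + h (ν k)) atTop (𝓝 I))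
    (hI : ∀ x ∈ orthant m, I ≤ θ ⬝ᵥ x + h x) : y ∈ smoothPoints h := by
  refine ⟨hy, (hh.differentiable_or_blowup y hy).resolve_right fun hblow => ?_⟩
  set H : (Fin m → ℝ) → ℝ := fun x => θ ⬝ᵥ x + h x with hH
  have hHtan : ∀ x ∈ orthant m, ∀ z ∈ smoothPoints h,
      H z + (θ + gradWithin h z) ⬝ᵥ (x - z) ≤ H x := by
    intro x hx z hz
    have := hh.tangent_le' hσ hx hz
    simp only [hH, add_dotProduct, dotProduct_sub] at this ⊢
    linarith
  set a : Fin m → Fin m → ℝ := fun j => y + Pi.single j 1 with ha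
  set C : ℝ := ∑ j, (|H (a j)| + |H (a j + 1)|) + |I| with hC
  have hC0 : 0 ≤ C := by positivity
  have hbound : ∀ t : ℝ, 0 < t → t ≤ 1 →
      ‖fderivWithin ℝ h (orthant m) (y + t • (1 : Fin m → ℝ))‖ ≤ ∑ j, (m * C + |θ j|) := by
    intro t ht ht1
    set z : Fin m → ℝ := y + t • (1 : Fin m → ℝ) with hz
    have hy' : ∀ j, 0 ≤ y j := hy
    have hzs : z ∈ smoothPoints h := hh.mem_smoothPoints_of_pos fun j => by
      have := hy' j
      simp [hz]; linarith
    have hsingle : ∀ j i, 0 ≤ (Pi.single j 1 : Fin m → ℝ) i := fun j i => by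
      rw [Pi.single_apply]; split_ifs <;> norm_num
    set w := θ + gradWithin h z with hw
    have hsum : 0 ≤ ∑ j, w j := by
      have h1 : Tendsto (fun k => H z + w ⬝ᵥ (ν k - z)) atTop (𝓝 (H z + w ⬝ᵥ (y - z))) := by
        have : Continuous fun x : Fin m → ℝ => H z + w ⬝ᵥ (x - z) := by
          simp only [dotProduct]; fun_prop
        exact (this.tendsto y).comp hνy
      have h2 := le_of_tendsto_of_tendsto' h1 hνI fun k => hHtan _ (hν k) z hzs
      have h3 := hI z hzs.1
      have h4 : y - z = (-t) • (1 : Fin m → ℝ) := by rw [hz]; simp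
      rw [h4, dotProduct_smul, dotProduct_one, smul_eq_mul] at h2
      have h5 : 0 ≤ t * ∑ j, w j := by
        have : I ≤ H z := h3
        linarith
      exact nonneg_of_mul_nonneg_right h5 ht
    have hupper : ∀ j, w j ≤ C := by
      intro j
      have hp : z + Pi.single j 1 ∈ smoothPoints h := hh.mem_smoothPoints_of_pos fun i => by
        have := hy' i
        have := hsingle j i
        simp only [hz, Pi.add_apply, Pi.smul_apply, Pi.one_apply, smul_eq_mul]; linarith
      have h1 := hHtan _ hp.1 z hzs
      rw [add_sub_cancel_left, dotProduct_single, mul_one] at h1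
      have h2 : I ≤ H z := hI z hzs.1
      have haj : a j ∈ orthant m := fun i => by
        have := hy' i
        have := hsingle j i
        simp only [ha, Pi.add_apply, Pi.zero_apply]; linarith
      have haj' : a j + 1 ∈ orthant m := fun i => by
        have : 0 ≤ a j i := haj i
        simp only [Pi.add_apply, Pi.zero_apply, Pi.one_apply]; linarith
      have h3 := hHtan _ haj _ hp
      have h4 := hHtan _ haj' _ hp
      have e3 : a j - (z + Pi.single j 1) = (-t) • (1 : Fin m → ℝ) := by
        rw [hz, ha]; simp only [neg_smul]; abel
      have e4 : a j + 1 - (z + Pi.single j 1) = (1 - t) • (1 : Fin m → ℝ) := by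
        rw [hz, ha]; simp only [sub_smul, one_smul]; abel
      rw [e3, dotProduct_smul, smul_eq_mul] at h3
      rw [e4, dotProduct_smul, smul_eq_mul] at h4
      have h5 : H (z + Pi.single j 1) ≤ (1 - t) * H (a j) + t * H (a j + 1) := by
        nlinarith
      have h6 : (1 - t) * H (a j) ≤ |H (a j)| := by
        have := abs_nonneg (H (a j))
        have := le_abs_self (H (a j))
        nlinarith
      have h7 : t * H (a j + 1) ≤ |H (a j + 1)| := by
        have := abs_nonneg (H (a j + 1))
        have := le_abs_self (H (a j + 1))
        nlinarith
      have h8 : |H (a j)| + |H (a j + 1)| ≤ ∑ j, (|H (a j)| + |H (a j + 1)|) :=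
        Finset.single_le_sum (f := fun j => |H (a j)| + |H (a j + 1)|)
          (fun _ _ => by positivity) (Finset.mem_univ j)
      have := neg_abs_le I
      rw [hC]
      linarith
    refine (norm_fderivWithin_le_sum_abs h z).trans (Finset.sum_le_sum fun j _ => ?_)
    have hm1 : (1 : ℝ) ≤ m := by
      have : 0 < m := Nat.pos_of_ne_zero fun h0 => (h0 ▸ j).elim0
      exact_mod_cast this
    have hlower : -(m * C) ≤ w j - C := by
      have h1 : ∑ i, (C - w i) = m * C - ∑ i, w i := by
        simp [Finset.sum_sub_distrib]
      have h2 : C - w j ≤ ∑ i, (C - w i) :=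
        Finset.single_le_sum (f := fun i => C - w i)
          (fun i _ => sub_nonneg.2 (hupper i)) (Finset.mem_univ j)
      linarith
    have hj : gradWithin h z j = w j - θ j := by simp [hw]
    have hwj : |w j| ≤ m * C := by
      have := hupper j
      rw [abs_le]
      constructor <;> nlinarith
    rw [hj]
    exact (abs_sub _ _).trans (by linarith)
  have htend : Tendsto (fun t : ℝ => y + t • (1 : Fin m → ℝ)) (𝓝[>] 0)
      (𝓝[{z | ∀ j, 0 < z j}] y) := by
    refine tendsto_nhdsWithin_iff.2 ⟨?_, ?_⟩
    · have : Continuous fun t : ℝ => y + t • (1 : Fin m → ℝ) := by fun_prop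
      have h0 := this.tendsto 0
      simp only [zero_smul, add_zero] at h0
      exact h0.mono_left nhdsWithin_le_nhds
    · filter_upwards [self_mem_nhdsWithin] with t ht j
      have : 0 ≤ y j := hy j
      have : 0 < t := ht
      simp; linarith
  have hev := (hblow.comp htend).eventually_gt_atTop (∑ j, (m * C + |θ j|))
  have hlt : ∀ᶠ t : ℝ in 𝓝[>] 0, t ∈ Set.Ioc (0 : ℝ) 1 := Ioc_mem_nhdsGT one_pos
  obtain ⟨t, ht, ht'⟩ := (hev.and hlt).exists
  exact absurd (hbound t ht'.1 ht'.2) (not_le.2 ht)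

theorem mem_smoothPoints_of_isMinOn (hh : IsReferenceFunction h σ) (hσ : 0 < σ)
    {θ y : Fin m → ℝ} (hy : y ∈ orthant m)
    (hmin : IsMinOn (fun x => θ ⬝ᵥ x + h x) (orthant m) y) : y ∈ smoothPoints h :=
  hh.mem_smoothPoints_of_tendsto_min hσ θ hy (fun _ : ℕ => hy) tendsto_const_nhds
    tendsto_const_nhds fun _ hx => hmin hx

theorem exists_isMinOn (hh : IsReferenceFunction h σ) (hσ : 0 < σ) (θ : Fin m → ℝ) :
    ∃ y ∈ orthant m, IsMinOn (fun x => θ ⬝ᵥ x + h x) (orthant m) y := by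
  set H : (Fin m → ℝ) → ℝ := fun x => θ ⬝ᵥ x + h x with hH
  have h1 : (1 : Fin m → ℝ) ∈ smoothPoints h := hh.mem_smoothPoints_of_pos fun j => by simp
  set p := θ + gradWithin h 1 with hp
  set r : (Fin m → ℝ) → ℝ := fun x => ∑ j, |x j - 1| with hr
  -- strong convexity at one point makes the objective grow quadratically
  have hgrow : ∀ x ∈ orthant m, H 1 - ‖p‖ * r x + σ / 2 * r x ^ 2 ≤ H x := by
    intro x hx
    have h2 := hh.tangent_le hx h1
    have h3 := dotProduct_le_mul_sum_abs (-p) (x - 1) (M := ‖p‖) fun j => by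
      rw [Pi.neg_apply, abs_neg]; exact norm_le_pi_norm p j
    rw [neg_dotProduct] at h3
    simp only [hH, hr, hp, add_dotProduct, dotProduct_sub, Pi.sub_apply, Pi.one_apply] at h2 h3 ⊢
    linarith
  have hbdd : BddBelow (H '' orthant m) := by
    refine ⟨H 1 - ‖p‖ ^ 2 / (2 * σ), ?_⟩
    rintro _ ⟨x, hx, rfl⟩
    refine le_trans ?_ (hgrow x hx)
    have : ‖p‖ ^ 2 / (2 * σ) - ‖p‖ * r x + σ / 2 * r x ^ 2 = (‖p‖ - σ * r x) ^ 2 / (2 * σ) := by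
      field_simp; ring
    have : 0 ≤ (‖p‖ - σ * r x) ^ 2 / (2 * σ) := by positivity
    linarith
  obtain ⟨v, -, hv, hmem⟩ := exists_seq_tendsto_sInf (⟨_, Set.mem_image_of_mem H h1.1⟩ :
    (H '' orthant m).Nonempty) hbdd
  choose ν hν hνv using hmem
  have hνI : Tendsto (fun k => H (ν k)) atTop (𝓝 (sInf (H '' orthant m))) := by
    simpa only [hνv] using hv
  obtain ⟨M, hM⟩ := hνI.bddAbove_range
  have hball : ∀ k, ν k ∈ Metric.closedBall (1 : Fin m → ℝ) ((2 * ‖p‖ + 2 * |M - H 1|) / σ + 1) := by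
    intro k
    rw [mem_closedBall_iff_norm]
    have hk : H (ν k) ≤ M := hM ⟨k, rfl⟩
    have h2 := hgrow _ (hν k)
    have h3 : ‖ν k - 1‖ ≤ r (ν k) := norm_le_sum_abs _
    refine h3.trans ?_
    by_contra! hlt
    have h4 : 0 ≤ (2 * ‖p‖ + 2 * |M - H 1|) / σ := by positivity
    have h5 : 1 < r (ν k) := by linarith
    have h6 : 2 * ‖p‖ + 2 * |M - H 1| < σ * r (ν k) := by
      have : (2 * ‖p‖ + 2 * |M - H 1|) / σ < r (ν k) := by linarith
      rwa [div_lt_iff₀' hσ] at this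
    have h7 := le_abs_self (M - H 1)
    have h8 := abs_nonneg (M - H 1)
    nlinarith
  obtain ⟨y, -, φ, hφ, hy⟩ := tendsto_subseq_of_bounded Metric.isBounded_closedBall hball
  have hyo : y ∈ orthant m :=
    (isClosed_orthant m).mem_of_tendsto hy (Eventually.of_forall fun k => hν (φ k))
  have hI : ∀ x ∈ orthant m, sInf (H '' orthant m) ≤ H x := fun x hx =>
    csInf_le hbdd ⟨x, hx, rfl⟩
  have hys : y ∈ smoothPoints h := hh.mem_smoothPoints_of_tendsto_min hσ θ hyo
    (fun k => hν (φ k)) hy (hνI.comp hφ.tendsto_atTop) hI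
  refine ⟨y, hyo, fun x hx => ?_⟩
  have hcont : ContinuousWithinAt H (orthant m) y := by
    have hlin : Continuous fun x : Fin m → ℝ => θ ⬝ᵥ x := by
      simp only [dotProduct]; fun_prop
    exact hlin.continuousWithinAt.add hys.2.continuousWithinAt
  have hlim : Tendsto (fun k => H (ν (φ k))) atTop (𝓝 (H y)) :=
    hcont.tendsto.comp (tendsto_nhdsWithin_iff.2 ⟨hy, Eventually.of_forall fun k => hν (φ k)⟩)
  have : H y = sInf (H '' orthant m) :=
    tendsto_nhds_unique hlim (hνI.comp hφ.tendsto_atTop)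
  exact this.trans_le (hI x hx)

theorem linArgmin_spec (hh : IsReferenceFunction h σ) (hσ : 0 < σ) (θ : Fin m → ℝ) :
    linArgmin h θ ∈ orthant m ∧ IsMinOn (fun x => θ ⬝ᵥ x + h x) (orthant m) (linArgmin h θ) :=
  Classical.epsilon_spec
    (p := fun ν => ν ∈ orthant m ∧ IsMinOn (fun x => θ ⬝ᵥ x + h x) (orthant m) ν)
    (hh.exists_isMinOn hσ θ)

/-- The first-order optimality condition for minimizing `θᵀν + h(ν)` over the orthant. -/
theorem variational_ineq (hh : IsReferenceFunction h σ) (hσ : 0 < σ) {θ y u : Fin m → ℝ}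
    (hy : y ∈ orthant m) (hmin : IsMinOn (fun x => θ ⬝ᵥ x + h x) (orthant m) y)
    (hu : u ∈ orthant m) : 0 ≤ (θ + gradWithin h y) ⬝ᵥ (u - y) := by
  have hys := hh.mem_smoothPoints_of_isMinOn hσ hy hmin
  set L : (Fin m → ℝ) →L[ℝ] ℝ := LinearMap.toContinuousLinearMap
    { toFun := fun x => θ ⬝ᵥ x
      map_add' := fun x y => dotProduct_add _ _ _
      map_smul' := fun c x => dotProduct_smul _ _ _ } with hL
  have hd : HasFDerivWithinAt (fun x => θ ⬝ᵥ x + h x) (L + fderivWithin ℝ h (orthant m) y)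
      (orthant m) y :=
    L.hasFDerivWithinAt.add hys.2.hasFDerivWithinAt
  have := IsLocalMinOn.hasFDerivWithinAt_nonneg hmin.localize hd
    (sub_mem_posTangentConeAt_of_segment_subset ((convex_orthant m).segment_subset hy hu))
  rw [add_apply, fderivWithin_eq_gradWithin_dotProduct] at this
  rw [add_dotProduct]
  exact this

/-- Minimizers depend on the linear term in a `1/σ`-Lipschitz way. -/
theorem sum_abs_sub_le_of_isMinOn (hh : IsReferenceFunction h σ) (hσ : 0 < σ)
    {θ₁ θ₂ y₁ y₂ : Fin m → ℝ}
    (hy₁ : y₁ ∈ orthant m) (hmin₁ : IsMinOn (fun x => θ₁ ⬝ᵥ x + h x) (orthant m) y₁)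
    (hy₂ : y₂ ∈ orthant m) (hmin₂ : IsMinOn (fun x => θ₂ ⬝ᵥ x + h x) (orthant m) y₂) :
    σ * ∑ j, |y₁ j - y₂ j| ≤ ‖θ₁ - θ₂‖ := by
  have v₁ := hh.variational_ineq hσ hy₁ hmin₁ hy₂
  have v₂ := hh.variational_ineq hσ hy₂ hmin₂ hy₁
  have t₁ := hh.tangent_le hy₂ (hh.mem_smoothPoints_of_isMinOn hσ hy₁ hmin₁)
  have t₂ := hh.tangent_le hy₁ (hh.mem_smoothPoints_of_isMinOn hσ hy₂ hmin₂)
  have hsymm : ∑ j, |y₂ j - y₁ j| = ∑ j, |y₁ j - y₂ j| :=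
    Finset.sum_congr rfl fun j _ => abs_sub_comm _ _
  rw [hsymm] at t₁
  have hd := dotProduct_le_mul_sum_abs (θ₁ - θ₂) (y₂ - y₁) (M := ‖θ₁ - θ₂‖)
    fun j => norm_le_pi_norm (θ₁ - θ₂) j
  have hsymm' : ∑ j, |(y₂ - y₁) j| = ∑ j, |y₁ j - y₂ j| := hsymm
  rw [hsymm'] at hd
  set r := ∑ j, |y₁ j - y₂ j| with hr
  have hr0 : 0 ≤ r := Finset.sum_nonneg fun _ _ => abs_nonneg _
  simp only [add_dotProduct, sub_dotProduct, dotProduct_sub] at v₁ v₂ t₁ t₂ hd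
  rcases hr0.eq_or_lt with h0 | h0
  · rw [← h0, mul_zero]; exact norm_nonneg _
  · refine le_of_mul_le_mul_right ?_ h0
    nlinarith

theorem eq_of_isMinOn (hh : IsReferenceFunction h σ) (hσ : 0 < σ) {θ y₁ y₂ : Fin m → ℝ}
    (hy₁ : y₁ ∈ orthant m) (hmin₁ : IsMinOn (fun x => θ ⬝ᵥ x + h x) (orthant m) y₁)
    (hy₂ : y₂ ∈ orthant m) (hmin₂ : IsMinOn (fun x => θ ⬝ᵥ x + h x) (orthant m) y₂) :
    y₁ = y₂ := by
  have h1 := hh.sum_abs_sub_le_of_isMinOn hσ hy₁ hmin₁ hy₂ hmin₂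
  rw [sub_self, norm_zero] at h1
  have h2 : ‖y₁ - y₂‖ ≤ ∑ j, |y₁ j - y₂ j| := norm_le_sum_abs _
  rw [← sub_eq_zero, ← norm_le_zero_iff]
  nlinarith

theorem continuous_linArgmin (hh : IsReferenceFunction h σ) (hσ : 0 < σ) :
    Continuous (linArgmin h) := by
  refine (LipschitzWith.of_dist_le_mul (K := (σ⁻¹).toNNReal) fun θ₁ θ₂ => ?_).continuous
  rw [Real.coe_toNNReal _ (inv_nonneg.2 hσ.le), dist_eq_norm, dist_eq_norm]
  have h1 := hh.sum_abs_sub_le_of_isMinOn hσ (hh.linArgmin_spec hσ θ₁).1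
    (hh.linArgmin_spec hσ θ₁).2 (hh.linArgmin_spec hσ θ₂).1 (hh.linArgmin_spec hσ θ₂).2
  have h2 := norm_le_sum_abs (linArgmin h θ₁ - linArgmin h θ₂)
  simp only [Pi.sub_apply] at h2
  rw [inv_mul_eq_div, le_div_iff₀' hσ]
  nlinarith

/-! ### The mirror descent step -/

/-- The mirror step depends on `(g, μ)` only through `η g - ∇h(μ)`. -/
theorem isMinOn_mirror_iff {η : ℝ} (hη : 0 < η) (g μ ν : Fin m → ℝ) :
    IsMinOn (fun ν' => g ⬝ᵥ ν' + (1 / η) * bregman h ν' μ) (orthant m) ν ↔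
      IsMinOn (fun x => (η • g - gradWithin h μ) ⬝ᵥ x + h x) (orthant m) ν := by
  have key : ∀ x, g ⬝ᵥ x + (1 / η) * bregman h x μ =
      (1 / η) * (((η • g - gradWithin h μ) ⬝ᵥ x + h x) + (gradWithin h μ ⬝ᵥ μ - h μ)) := by
    intro x
    rw [bregman_eq, sub_dotProduct, smul_dotProduct, dotProduct_sub, smul_eq_mul]
    field_simp
    ring
  refine forall_congr' fun x => ?_
  refine imp_congr_right fun _ => ?_
  simp only [Set.mem_ofPred_eq]
  rw [key, key, mul_le_mul_iff_right₀ (by positivity), add_le_add_iff_right]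

theorem mirrorStep_eq (hh : IsReferenceFunction h σ) (hσ : 0 < σ) {η : ℝ} (hη : 0 < η)
    (g μ : Fin m → ℝ) :
    mirrorStep h η g μ = linArgmin h (η • g - gradWithin h μ) := by
  have h1 := hh.linArgmin_spec hσ (η • g - gradWithin h μ)
  have h2 := Classical.epsilon_spec (p := fun ν => ν ∈ orthant m ∧
    IsMinOn (fun ν' => g ⬝ᵥ ν' + (1 / η) * bregman h ν' μ) (orthant m) ν)
    ⟨_, h1.1, (isMinOn_mirror_iff hη g μ _).2 h1.2⟩
  exact hh.eq_of_isMinOn hσ h2.1 ((isMinOn_mirror_iff hη g μ _).1 h2.2) h1.1 h1.2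

theorem mirrorStep_mem_smoothPoints (hh : IsReferenceFunction h σ) (hσ : 0 < σ) {η : ℝ}
    (hη : 0 < η) (g μ : Fin m → ℝ) : mirrorStep h η g μ ∈ smoothPoints h := by
  rw [hh.mirrorStep_eq hσ hη]
  have h1 := hh.linArgmin_spec hσ (η • g - gradWithin h μ)
  exact hh.mem_smoothPoints_of_isMinOn hσ h1.1 h1.2

/-- The one-step regret inequality of mirror descent against an arbitrary comparator `u`. -/
theorem mirrorStep_regret (hh : IsReferenceFunction h σ) (hσ : 0 < σ) {η : ℝ} (hη : 0 < η)
    {g μ u : Fin m → ℝ} {M : ℝ} (hM : ∀ j, |g j| ≤ M) (hμ : μ ∈ smoothPoints h)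
    (hu : u ∈ orthant m) :
    g ⬝ᵥ (μ - u) ≤ (1 / η) * (bregman h u μ - bregman h u (mirrorStep h η g μ)) +
      η * M ^ 2 / (2 * σ) := by
  have hmin := hh.linArgmin_spec hσ (η • g - gradWithin h μ)
  rw [← hh.mirrorStep_eq hσ hη] at hmin
  have hνs := hh.mirrorStep_mem_smoothPoints hσ hη g μ
  set ν := mirrorStep h η g μ with hν
  have v := hh.variational_ineq hσ hmin.1 hmin.2 hu
  have t := hh.bregman_ge hmin.1 hμ
  have d := dotProduct_le_mul_sum_abs g (μ - ν) hM
  have hsymm : ∑ j, |(μ - ν) j| = ∑ j, |ν j - μ j| :=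
    Finset.sum_congr rfl fun j _ => abs_sub_comm _ _
  rw [hsymm] at d
  set r := ∑ j, |ν j - μ j| with hr
  -- the three-point identity for Bregman divergences
  have e : bregman h u μ - bregman h u ν =
      bregman h ν μ + (gradWithin h ν - gradWithin h μ) ⬝ᵥ (u - ν) := by
    simp only [bregman_eq, sub_dotProduct, dotProduct_sub]
    ring
  have e2 : (gradWithin h ν - gradWithin h μ) ⬝ᵥ (u - ν) =
      (η • g - gradWithin h μ + gradWithin h ν) ⬝ᵥ (u - ν) + η * (g ⬝ᵥ (μ - u)) -
        η * (g ⬝ᵥ (μ - ν)) := by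
    simp only [add_dotProduct, sub_dotProduct, dotProduct_sub, smul_dotProduct, smul_eq_mul]
    ring
  have e3 : η * (M * r) - σ / 2 * r ^ 2 ≤ η * (η * M ^ 2 / (2 * σ)) := by
    have : η * (η * M ^ 2 / (2 * σ)) - (η * (M * r) - σ / 2 * r ^ 2) =
        (η * M - σ * r) ^ 2 / (2 * σ) := by
      field_simp; ring
    have : 0 ≤ (η * M - σ * r) ^ 2 / (2 * σ) := by positivity
    linarith
  have e4 : η * (g ⬝ᵥ (μ - ν)) ≤ η * (M * r) := mul_le_mul_of_nonneg_left d hη.le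
  refine le_of_mul_le_mul_left ?_ hη
  rw [mul_add, ← mul_assoc, mul_one_div_cancel hη.ne', one_mul]
  linarith

end IsReferenceFunction

/-! ### Sample paths of the algorithm -/

/-- Every resource has at least `bbar` left, so that no proposed action can be rejected. -/
def AlgState.Ample {m : ℕ} (bbar : ℝ) (s : AlgState m) : Prop := ∀ j, bbar ≤ s.remaining j

namespace AlgInput

variable {d m : ℕ} {S : Set (Request d m)} (A : AlgInput S)

/-- `F(μ_t) + μ_tᵀ b_t(x̃_t)` as long as the resources are ample, and `0` afterwards.  For
`F(μ) = 𝔼 [max_x {f(x) - μᵀ b(x)}]` its conditional expectation is that of the reward `f_t(x̃_t)`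
collected while resources are ample. -/
noncomputable def credit (bbar : ℝ) (F : (Fin m → ℝ) → ℝ) (s : AlgState m) (γ : S) : ℝ :=
  open Classical in
  if s.Ample bbar then F s.dual + s.dual ⬝ᵥ γ.1.consumption (A.oracle γ s.dual) else 0

theorem stateAt_last {n : ℕ} (γ : Fin (n + 1) → S) :
    A.stateAt γ (Fin.last n) = A.state n (Fin.init γ) := rfl

theorem action_eq_oracle_of_ample {bbar : ℝ} (hb : ∀ γ ∈ S, ∀ x j, |γ.consumption x j| ≤ bbar)
    {s : AlgState m} (hs : s.Ample bbar) (γ : S) : A.action s γ = A.oracle γ s.dual :=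
  if_pos fun j => (le_abs_self _).trans ((hb γ.1 γ.2 _ j).trans (hs j))

theorem gradientConsumption_of_ample {bbar : ℝ}
    (hb : ∀ γ ∈ S, ∀ x j, |γ.consumption x j| ≤ bbar)
    {s : AlgState m} (hs : s.Ample bbar) (γ : S) :
    A.gradientConsumption s γ = γ.1.consumption (A.action s γ) := by
  unfold gradientConsumption
  cases A.gradientRule
  · simp only [A.action_eq_oracle_of_ample hb hs γ]
  · rfl

theorem abs_target_sub_gradientConsumption_le {bbar lbar : ℝ} {l : Fin m → ℝ}
    (hb : ∀ γ ∈ S, ∀ x j, |γ.consumption x j| ≤ bbar) (hl0 : ∀ j, 0 ≤ l j) (hl : ∀ j, l j ≤ lbar)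
    (s : AlgState m) (γ : S) (j : Fin m) :
    |(l - A.gradientConsumption s γ) j| ≤ bbar + lbar := by
  have key : ∀ x, |(l - γ.1.consumption x) j| ≤ bbar + lbar := fun x => by
    have h1 := hb γ.1 γ.2 x j
    have h2 := abs_sub (l j) (γ.1.consumption x j)
    rw [abs_of_nonneg (hl0 j)] at h2
    have := hl j
    rw [Pi.sub_apply]
    linarith
  unfold gradientConsumption
  cases A.gradientRule <;> exact key _

theorem remaining_state : ∀ (n : ℕ) (γ : Fin n → S), (A.state n γ).remaining =
    A.budget - ∑ t, (γ t).1.consumption (A.action (A.stateAt γ t) (γ t))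
  | 0, _ => by simp [state]
  | n + 1, γ => by
    rw [Fin.sum_univ_castSucc, ← sub_sub]
    exact congrArg (· - _) (remaining_state n (Fin.init γ))

theorem dual_state_mem {σ : ℝ} (hσ : 0 < σ) (hh : IsReferenceFunction A.refFun σ)
    (hη : 0 < A.stepSize) (h₁ : A.initDual ∈ smoothPoints A.refFun) :
    ∀ (n : ℕ) (γ : Fin n → S), (A.state n γ).dual ∈ smoothPoints A.refFun
  | 0, _ => h₁
  | _ + 1, _ => hh.mirrorStep_mem_smoothPoints hσ hη _ _

/-- The regret of the dual variables on a sample path, against an arbitrary comparator `u`. -/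
theorem regret_le {σ M : ℝ} {N : ℕ} (hσ : 0 < σ) (hh : IsReferenceFunction A.refFun σ)
    (hη : 0 < A.stepSize) (h₁ : A.initDual ∈ smoothPoints A.refFun)
    (hM : ∀ n < N, ∀ s γ j, |(A.target n - A.gradientConsumption s γ) j| ≤ M)
    {u : Fin m → ℝ} (hu : u ∈ orthant m) :
    ∀ (n : ℕ) (_ : n ≤ N) (γ : Fin n → S),
      ∑ t : Fin n, (A.target t - A.gradientConsumption (A.stateAt γ t) (γ t)) ⬝ᵥ
          ((A.stateAt γ t).dual - u) ≤
        (1 / A.stepSize) * (bregman A.refFun u A.initDual -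
          bregman A.refFun u (A.state n γ).dual) + n * (A.stepSize * M ^ 2 / (2 * σ))
  | 0, _, γ => by simp [state]
  | n + 1, hn, γ => by
    rw [Fin.sum_univ_castSucc]
    have ih := regret_le hσ hh hη h₁ hM hu n (by omega) (Fin.init γ)
    have hstep := hh.mirrorStep_regret hσ hη
      (hM n hn (A.state n (Fin.init γ)) (γ (Fin.last n)))
      (A.dual_state_mem hσ hh hη h₁ n (Fin.init γ)) hu
    have hsum := add_le_add ih hstep
    refine hsum.trans (le_of_eq ?_)
    have : (A.state (n + 1) γ).dual = mirrorStep A.refFun A.stepSize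
      (A.target n - A.gradientConsumption (A.state n (Fin.init γ)) (γ (Fin.last n)))
      (A.state n (Fin.init γ)).dual := rfl
    rw [this]
    push_cast
    ring

/-- The regret bound restated for the credit, on a path along which resources stay ample. -/
theorem credit_ge_of_ample {σ M bbar : ℝ} {N : ℕ} (hσ : 0 < σ)
    (hh : IsReferenceFunction A.refFun σ) (hη : 0 < A.stepSize)
    (h₁ : A.initDual ∈ smoothPoints A.refFun)
    (hb : ∀ γ ∈ S, ∀ x j, |γ.consumption x j| ≤ bbar)
    (hM : ∀ n < N, ∀ s γ j, |(A.target n - A.gradientConsumption s γ) j| ≤ M)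
    {F : (Fin m → ℝ) → ℝ} {a : ℕ → ℝ}
    (hFa : ∀ t < N, ∀ μ ∈ orthant m, a t ≤ F μ + μ ⬝ᵥ A.target t)
    {u : Fin m → ℝ} (hu : u ∈ orthant m) {n : ℕ} (hn : n ≤ N) (γ : Fin n → S)
    (hγ : ∀ t, (A.stateAt γ t).Ample bbar) :
    ∑ t ∈ Finset.range n, a t +
        u ⬝ᵥ (A.budget - (A.state n γ).remaining - ∑ t ∈ Finset.range n, A.target t) -
        (1 / A.stepSize) * bregman A.refFun u A.initDual - n * (A.stepSize * M ^ 2 / (2 * σ)) ≤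
      ∑ t, A.credit bbar F (A.stateAt γ t) (γ t) := by
  have hreg := A.regret_le hσ hh hη h₁ hM hu n hn γ
  have hV : 0 ≤ (1 / A.stepSize) * bregman A.refFun u (A.state n γ).dual :=
    mul_nonneg (by positivity)
      (hh.bregman_nonneg hσ hu (A.dual_state_mem hσ hh hη h₁ n γ))
  have hterm : ∀ t : Fin n, a t -
      (A.target t - A.gradientConsumption (A.stateAt γ t) (γ t)) ⬝ᵥ ((A.stateAt γ t).dual - u) -
      (u ⬝ᵥ A.target t - u ⬝ᵥ (γ t).1.consumption (A.action (A.stateAt γ t) (γ t))) ≤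
      A.credit bbar F (A.stateAt γ t) (γ t) := by
    intro t
    have h1 := hFa t (t.isLt.trans_le hn) _
      (A.dual_state_mem hσ hh hη h₁ t fun i => γ (Fin.castLE t.isLt.le i)).1
    change _ ≤ F (A.stateAt γ t).dual + (A.stateAt γ t).dual ⬝ᵥ _ at h1
    rw [credit, if_pos (hγ t), A.gradientConsumption_of_ample hb (hγ t),
      ← A.action_eq_oracle_of_ample hb (hγ t)]
    rw [sub_dotProduct, dotProduct_sub, dotProduct_sub, dotProduct_comm (A.target t),
      dotProduct_comm _ (A.stateAt γ t).dual, dotProduct_comm _ u, dotProduct_comm _ u]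
    linarith
  have hsum := Finset.sum_le_sum fun t (_ : t ∈ Finset.univ) => hterm t
  simp only [Finset.sum_sub_distrib] at hsum
  have e1 : A.budget - (A.state n γ).remaining =
      ∑ t, (γ t).1.consumption (A.action (A.stateAt γ t) (γ t)) := by
    rw [A.remaining_state n γ, sub_sub_cancel]
  rw [e1, dotProduct_sub, dotProduct_sum, dotProduct_sum, Finset.sum_range, Finset.sum_range]
  rw [mul_sub] at hreg
  linarith

/-- Once some resource `j` is no longer ample, comparing with `u = κ eⱼ` pays for all later
periods: each loses at most `a t ≤ κ λ_{t,j}`, which is what remains of the budget for `j`. -/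
theorem ample_or_credit_ge {σ M bbar κ : ℝ} {N : ℕ} (hσ : 0 < σ)
    (hh : IsReferenceFunction A.refFun σ) (hη : 0 < A.stepSize)
    (h₁ : A.initDual ∈ smoothPoints A.refFun)
    (hb : ∀ γ ∈ S, ∀ x j, |γ.consumption x j| ≤ bbar)
    (hM : ∀ n < N, ∀ s γ j, |(A.target n - A.gradientConsumption s γ) j| ≤ M)
    {F : (Fin m → ℝ) → ℝ} {a : ℕ → ℝ} (hF : ∀ μ ∈ orthant m, 0 ≤ F μ)
    (hFa : ∀ t < N, ∀ μ ∈ orthant m, a t ≤ F μ + μ ⬝ᵥ A.target t)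
    (hκ : 0 ≤ κ) (hκa : ∀ t < N, ∀ j, a t ≤ κ * A.target t j) :
    ∀ (n : ℕ) (_ : n ≤ N) (γ : Fin n → S),
      (∀ t, (A.stateAt γ t).Ample bbar) ∨
      ∃ j, ∑ t ∈ Finset.range n, a t +
          κ * (A.budget j - bbar - ∑ t ∈ Finset.range n, A.target t j) -
          (1 / A.stepSize) * bregman A.refFun (Pi.single j κ) A.initDual -
          n * (A.stepSize * M ^ 2 / (2 * σ)) ≤
        ∑ t, A.credit bbar F (A.stateAt γ t) (γ t)
  | 0, _, γ => Or.inl fun t => t.elim0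
  | n + 1, hn, γ => by
    have hcredit : 0 ≤ A.credit bbar F (A.stateAt γ (Fin.last n)) (γ (Fin.last n)) := by
      have hμ := (A.dual_state_mem hσ hh hη h₁ n (Fin.init γ)).1
      rw [stateAt_last, credit]
      split_ifs
      · refine add_nonneg (hF _ hμ) (Finset.sum_nonneg fun j _ => mul_nonneg (hμ j) ?_)
        exact (γ (Fin.last n)).1.consumption_nonneg _ j
      · exact le_rfl
    have hK : 0 ≤ A.stepSize * M ^ 2 / (2 * σ) := by positivity
    have hextend : ∀ j, (∑ t ∈ Finset.range n, a t +
          κ * (A.budget j - bbar - ∑ t ∈ Finset.range n, A.target t j) -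
          (1 / A.stepSize) * bregman A.refFun (Pi.single j κ) A.initDual -
          n * (A.stepSize * M ^ 2 / (2 * σ)) ≤
        ∑ t, A.credit bbar F (A.stateAt (Fin.init γ) t) (Fin.init γ t)) →
        ∑ t ∈ Finset.range (n + 1), a t +
          κ * (A.budget j - bbar - ∑ t ∈ Finset.range (n + 1), A.target t j) -
          (1 / A.stepSize) * bregman A.refFun (Pi.single j κ) A.initDual -
          (n + 1 : ℕ) * (A.stepSize * M ^ 2 / (2 * σ)) ≤
        ∑ t, A.credit bbar F (A.stateAt γ t) (γ t) := by
      intro j hj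
      have h2 := hκa n hn j
      rw [Fin.sum_univ_castSucc, Finset.sum_range_succ, Finset.sum_range_succ]
      refine le_trans ?_ (add_le_add hj hcredit)
      push_cast
      linarith
    rcases ample_or_credit_ge hσ hh hη h₁ hb hM hF hFa hκ hκa n (by omega) (Fin.init γ) with
      hall | ⟨j, hj⟩
    · by_cases hlast : (A.stateAt γ (Fin.last n)).Ample bbar
      · exact Or.inl (Fin.lastCases hlast hall)
      · simp only [AlgState.Ample, not_forall, not_le, stateAt_last] at hlast
        obtain ⟨j, hj⟩ := hlast
        refine Or.inr ⟨j, hextend j ?_⟩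
        have hu : (Pi.single j κ : Fin m → ℝ) ∈ orthant m := Pi.single_nonneg.2 hκ
        have h2 := A.credit_ge_of_ample hσ hh hη h₁ hb hM hFa hu (Nat.le_of_succ_le hn)
          (Fin.init γ) hall
        rw [single_dotProduct] at h2
        simp only [Pi.sub_apply, Finset.sum_apply] at h2
        have h3 := mul_le_mul_of_nonneg_left hj.le hκ
        linarith
    · exact Or.inr ⟨j, hextend j hj⟩

/-- The pathwise guarantee. -/
theorem credit_ge {σ M bbar κ : ℝ} {N : ℕ} (hσ : 0 < σ)
    (hh : IsReferenceFunction A.refFun σ) (hη : 0 < A.stepSize)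
    (h₁ : A.initDual ∈ smoothPoints A.refFun) (hbbar : 0 ≤ bbar)
    (hb : ∀ γ ∈ S, ∀ x j, |γ.consumption x j| ≤ bbar)
    (hM : ∀ n < N, ∀ s γ j, |(A.target n - A.gradientConsumption s γ) j| ≤ M)
    {F : (Fin m → ℝ) → ℝ} {a : ℕ → ℝ} (hF : ∀ μ ∈ orthant m, 0 ≤ F μ)
    (hFa : ∀ t < N, ∀ μ ∈ orthant m, a t ≤ F μ + μ ⬝ᵥ A.target t)
    (hκ : 0 ≤ κ) (hκa : ∀ t < N, ∀ j, a t ≤ κ * A.target t j)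
    (hlam : IsTargetSequence A.budget N A.target) {T : ℕ} (hT : T ≤ N) (γ : Fin T → S) :
    ∑ t ∈ Finset.range T, a t - κ * bbar - T * (A.stepSize * M ^ 2 / (2 * σ)) -
        (1 / A.stepSize) * max (bregman A.refFun 0 A.initDual)
          (⨆ j : Fin m, bregman A.refFun (Pi.single j κ) A.initDual) ≤
      ∑ t, A.credit bbar F (A.stateAt γ t) (γ t) := by
  have hη' : 0 ≤ 1 / A.stepSize := by positivity
  rcases A.ample_or_credit_ge hσ hh hη h₁ hb hM hF hFa hκ hκa T hT γ with hall | ⟨j, hj⟩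
  · have h2 := A.credit_ge_of_ample hσ hh hη h₁ hb hM hFa (u := 0) (fun _ => le_rfl) hT γ hall
    rw [zero_dotProduct] at h2
    have h3 := mul_le_mul_of_nonneg_left (le_max_left (bregman A.refFun 0 A.initDual)
      (⨆ j : Fin m, bregman A.refFun (Pi.single j κ) A.initDual)) hη'
    have h4 := mul_nonneg hκ hbbar
    linarith
  · have h3 := mul_le_mul_of_nonneg_left ((le_ciSup (Set.finite_range fun j : Fin m =>
      bregman A.refFun (Pi.single j κ) A.initDual).bddAbove j).trans
        (le_max_right (bregman A.refFun 0 A.initDual) _)) hη'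
    have h4 : ∑ t ∈ Finset.range T, A.target t j ≤ A.budget j := by
      refine le_trans (Finset.sum_le_sum_of_subset_of_nonneg (Finset.range_mono hT) fun t ht _ => ?_)
        ((Finset.sum_apply j (Finset.range N) A.target).symm.trans_le (hlam.sum_le j))
      exact hlam.nonneg t (Finset.mem_range.1 ht) j
    have h5 := mul_nonneg hκ (sub_nonneg.2 h4)
    linarith

end AlgInput

/-! ### Measurability of the state -/

namespace IsReferenceFunction

variable {m : ℕ} {h : (Fin m → ℝ) → ℝ} {σ : ℝ}

theorem continuousOn_smoothPoints (h : (Fin m → ℝ) → ℝ) : ContinuousOn h (smoothPoints h) :=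
  fun _ hy => hy.2.continuousWithinAt.mono fun _ hz => hz.1

/-- In a direction `w` pointing into the interior, the directional derivative is a pointwise limit
of difference quotients that are continuous on the points of differentiability. -/
theorem measurable_gradWithin_dotProduct (hh : IsReferenceFunction h σ) {w : Fin m → ℝ}
    (hw : ∀ j, 0 < w j) : Measurable fun p : smoothPoints h => gradWithin h p ⬝ᵥ w := by
  set c : ℕ → ℝ := fun n => (n : ℝ) + 1 with hc
  have hc0 : ∀ n, 0 < c n := fun n => by positivity
  have hmem : ∀ (n : ℕ) (p : smoothPoints h), (p : Fin m → ℝ) + (c n)⁻¹ • w ∈ smoothPoints h := by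
    intro n p
    refine hh.mem_smoothPoints_of_pos fun j => ?_
    have h1 : 0 ≤ (p : Fin m → ℝ) j := p.2.1 j
    have h2 : 0 < (c n)⁻¹ * w j := mul_pos (inv_pos.2 (hc0 n)) (hw j)
    simp only [Pi.add_apply, Pi.smul_apply, smul_eq_mul]
    linarith
  refine measurable_of_tendsto_metrizable
    (f := fun n (p : smoothPoints h) => c n • (h (p + (c n)⁻¹ • w) - h p)) (fun n => ?_) ?_
  · have h1 : Continuous fun p : smoothPoints h => h (p + (c n)⁻¹ • w) :=
      (continuousOn_smoothPoints h).comp_continuous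
        (continuous_subtype_val.add continuous_const) (hmem n)
    have h2 : Continuous fun p : smoothPoints h => h p :=
      (continuousOn_smoothPoints h).comp_continuous continuous_subtype_val fun p => p.2
    exact ((h1.sub h2).const_smul (c n)).measurable
  · refine tendsto_pi_nhds.2 fun p => ?_
    rw [← fderivWithin_eq_gradWithin_dotProduct]
    refine p.2.2.hasFDerivWithinAt.lim ?_ (Eventually.of_forall fun n => (hmem n p).1) ?_
    · have h1 : Tendsto c atTop atTop :=
        tendsto_atTop_add_const_right _ _ tendsto_natCast_atTop_atTop
      simpa only [zero_smul, Pi.inv_apply] using h1.inv_tendsto_atTop.smul_const w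
    · simp only [smul_smul, mul_inv_cancel₀ (hc0 _).ne', one_smul]
      exact tendsto_const_nhds

theorem measurable_gradWithin (hh : IsReferenceFunction h σ) :
    Measurable fun p : smoothPoints h => gradWithin h p := by
  refine measurable_pi_lambda _ fun j => ?_
  have h1 := hh.measurable_gradWithin_dotProduct (w := Pi.single j 1 + 1) fun i => by
    have : 0 ≤ (Pi.single j 1 : Fin m → ℝ) i := by
      rw [Pi.single_apply]; split_ifs <;> norm_num
    simp only [Pi.add_apply, Pi.one_apply]; linarith
  have h2 := hh.measurable_gradWithin_dotProduct (w := 1) fun i => one_pos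
  convert h1.sub h2 using 1
  funext p
  simp only [Pi.sub_apply, dotProduct_add, dotProduct_single, mul_one, add_sub_cancel_right]

end IsReferenceFunction

namespace AlgInput

variable {d m : ℕ} {S : Set (Request d m)} [MeasurableSpace S] (A : AlgInput S)
  {Ω : Type*} [MeasurableSpace Ω] {X : Ω → S} {s : Ω → AlgState m}

theorem measurable_oracle_consumption (hA : IsBestResponse A.oracle) (hX : Measurable X)
    (hs : Measurable fun ω => (s ω).dual) (ho : ∀ ω, (s ω).dual ∈ orthant m) :
    Measurable fun ω => (X ω).1.consumption (A.oracle (X ω) (s ω).dual) :=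
  hA.measurable_consumption.comp (hX.prodMk (hs.subtype_mk (h := ho)))

theorem measurable_oracle_reward (hA : IsBestResponse A.oracle) (hX : Measurable X)
    (hs : Measurable fun ω => (s ω).dual) (ho : ∀ ω, (s ω).dual ∈ orthant m) :
    Measurable fun ω => (X ω).1.reward (A.oracle (X ω) (s ω).dual) :=
  hA.measurable_reward.comp (hX.prodMk (hs.subtype_mk (h := ho)))

theorem measurable_action_consumption (hA : IsBestResponse A.oracle) (hX : Measurable X)
    (hs : Measurable fun ω => (s ω).dual) (ho : ∀ ω, (s ω).dual ∈ orthant m)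
    (hr : Measurable fun ω => (s ω).remaining) :
    Measurable fun ω => (X ω).1.consumption (A.action (s ω) (X ω)) := by
  classical
  have hc := A.measurable_oracle_consumption hA hX hs ho
  have key : Measurable fun ω =>
      if (X ω).1.consumption (A.oracle (X ω) (s ω).dual) ≤ (s ω).remaining then
        (X ω).1.consumption (A.oracle (X ω) (s ω).dual) else 0 :=
    Measurable.ite (measurableSet_le hc hr) hc measurable_const
  convert key using 1
  funext ω
  unfold action
  by_cases hω : (X ω).1.consumption (A.oracle (X ω) (s ω).dual) ≤ (s ω).remaining
  · simp only [hω, if_true]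
  · simp only [hω, if_false]
    exact (X ω).1.consumption_zero

theorem measurable_action_reward (hA : IsBestResponse A.oracle)
    (hvoid : Measurable fun γ : S => γ.1.reward γ.1.void) (hX : Measurable X)
    (hs : Measurable fun ω => (s ω).dual) (ho : ∀ ω, (s ω).dual ∈ orthant m)
    (hr : Measurable fun ω => (s ω).remaining) :
    Measurable fun ω => (X ω).1.reward (A.action (s ω) (X ω)) := by
  classical
  have hc := A.measurable_oracle_consumption hA hX hs ho
  have key : Measurable fun ω =>
      if (X ω).1.consumption (A.oracle (X ω) (s ω).dual) ≤ (s ω).remaining then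
        (X ω).1.reward (A.oracle (X ω) (s ω).dual) else (X ω).1.reward (X ω).1.void :=
    Measurable.ite (measurableSet_le hc hr) (A.measurable_oracle_reward hA hX hs ho)
      (hvoid.comp hX)
  convert key using 1
  funext ω
  unfold action
  by_cases hω : (X ω).1.consumption (A.oracle (X ω) (s ω).dual) ≤ (s ω).remaining
  · simp only [hω, if_true]
  · simp only [hω, if_false]

theorem measurable_gradientConsumption (hA : IsBestResponse A.oracle) (hX : Measurable X)
    (hs : Measurable fun ω => (s ω).dual) (ho : ∀ ω, (s ω).dual ∈ orthant m)
    (hr : Measurable fun ω => (s ω).remaining) :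
    Measurable fun ω => A.gradientConsumption (s ω) (X ω) := by
  unfold gradientConsumption
  cases A.gradientRule
  · exact A.measurable_oracle_consumption hA hX hs ho
  · exact A.measurable_action_consumption hA hX hs ho hr

theorem measurable_state {σ : ℝ} (hσ : 0 < σ) (hh : IsReferenceFunction A.refFun σ)
    (hη : 0 < A.stepSize) (h₁ : A.initDual ∈ smoothPoints A.refFun)
    (hA : IsBestResponse A.oracle) :
    ∀ n : ℕ, Measurable (fun γ : Fin n → S => (A.state n γ).dual) ∧
      Measurable (fun γ : Fin n → S => (A.state n γ).remaining)
  | 0 => ⟨measurable_const, measurable_const⟩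
  | n + 1 => by
    obtain ⟨ihd, ihr⟩ := measurable_state hσ hh hη h₁ hA n
    have hinit : Measurable fun γ : Fin (n + 1) → S => (Fin.init γ : Fin n → S) :=
      measurable_pi_lambda _ fun i => measurable_pi_apply _
    have hX : Measurable fun γ : Fin (n + 1) → S => γ (Fin.last n) := measurable_pi_apply _
    have hd : Measurable fun γ : Fin (n + 1) → S => (A.state n (Fin.init γ)).dual :=
      ihd.comp hinit
    have hr : Measurable fun γ : Fin (n + 1) → S => (A.state n (Fin.init γ)).remaining :=
      ihr.comp hinit
    have hmem : ∀ γ : Fin (n + 1) → S, (A.state n (Fin.init γ)).dual ∈ smoothPoints A.refFun :=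
      fun γ => A.dual_state_mem hσ hh hη h₁ n _
    have ho : ∀ γ : Fin (n + 1) → S, (A.state n (Fin.init γ)).dual ∈ orthant m :=
      fun γ => (hmem γ).1
    refine ⟨?_, hr.sub (A.measurable_action_consumption (s := fun γ => A.state n (Fin.init γ))
      hA hX hd ho hr)⟩
    have hg := A.measurable_gradientConsumption (s := fun γ => A.state n (Fin.init γ))
      hA hX hd ho hr
    have hgrad := hh.measurable_gradWithin.comp (hd.subtype_mk (h := hmem))
    convert (hh.continuous_linArgmin hσ).measurable.comp
      (((measurable_const (a := A.target n)).sub hg).const_smul A.stepSize |>.sub hgrad) using 1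
    funext γ
    exact hh.mirrorStep_eq hσ hη _ _

end AlgInput

/-! ### The dual function and the hindsight optimum -/

/-- `max_x {f(x) - μᵀ b(x)}` when `oracle` is a best response. -/
noncomputable def bestValue {d m : ℕ} {S : Set (Request d m)} (oracle : (γ : S) → (Fin m → ℝ) → γ.1.actions)
    (γ : S) (μ : Fin m → ℝ) : ℝ :=
  γ.1.reward (oracle γ μ) - μ ⬝ᵥ γ.1.consumption (oracle γ μ)

theorem bestValue_le {d m : ℕ} {S : Set (Request d m)}
    {oracle : (γ : S) → (Fin m → ℝ) → γ.1.actions}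
    {fbar : ℝ} (hf : ∀ γ ∈ S, ∀ x, |γ.reward x| ≤ fbar) (γ : S)
    {μ : Fin m → ℝ} (hμ : μ ∈ orthant m) : bestValue oracle γ μ ≤ fbar := by
  have h1 := (le_abs_self _).trans (hf γ.1 γ.2 (oracle γ μ))
  have h2 : 0 ≤ μ ⬝ᵥ γ.1.consumption (oracle γ μ) :=
    Finset.sum_nonneg fun j _ => mul_nonneg (hμ j) (γ.1.consumption_nonneg _ j)
  rw [bestValue]
  linarith

namespace IsBestResponse

variable {d m : ℕ} {S : Set (Request d m)} [MeasurableSpace S]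
  {oracle : (γ : S) → (Fin m → ℝ) → γ.1.actions}

theorem bestValue_nonneg (ho : IsBestResponse oracle) (γ : S) {μ : Fin m → ℝ}
    (hμ : μ ∈ orthant m) : 0 ≤ bestValue oracle γ μ := by
  refine le_trans ?_ (ho.isMax γ μ hμ γ.1.void)
  rw [Request.void, γ.1.consumption_zero, dotProduct_zero, sub_zero]
  exact γ.1.reward_nonneg _

theorem norm_bestValue_le (ho : IsBestResponse oracle) {fbar : ℝ}
    (hf : ∀ γ ∈ S, ∀ x, |γ.reward x| ≤ fbar) (γ : S) {μ : Fin m → ℝ} (hμ : μ ∈ orthant m) :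
    ‖bestValue oracle γ μ‖ ≤ fbar := by
  rw [Real.norm_eq_abs, abs_of_nonneg (ho.bestValue_nonneg γ hμ)]
  exact bestValue_le hf γ hμ

theorem measurable_bestValue (ho : IsBestResponse oracle) :
    Measurable fun p : S × orthant m => bestValue oracle p.1 p.2.1 := by
  have h1 : Continuous fun q : (Fin m → ℝ) × (Fin m → ℝ) => q.1 ⬝ᵥ q.2 := by
    simp only [dotProduct]; fun_prop
  exact ho.measurable_reward.sub (h1.measurable.comp
    ((measurable_subtype_coe.comp measurable_snd).prodMk ho.measurable_consumption))

theorem integrable_bestValue (ho : IsBestResponse oracle) {fbar : ℝ}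
    (hf : ∀ γ ∈ S, ∀ x, |γ.reward x| ≤ fbar) (P : Measure S) [IsProbabilityMeasure P]
    {μ : Fin m → ℝ} (hμ : μ ∈ orthant m) : Integrable (fun γ => bestValue oracle γ μ) P :=
  Integrable.of_bound (ho.measurable_bestValue.comp
    (measurable_id.prodMk (measurable_const (a := (⟨μ, hμ⟩ : orthant m))))).aestronglyMeasurable
    fbar (Eventually.of_forall fun γ => ho.norm_bestValue_le hf γ hμ)

theorem measurable_integral_bestValue (ho : IsBestResponse oracle) (P : Measure S)
    [IsProbabilityMeasure P] :
    Measurable fun μ : orthant m => ∫ γ, bestValue oracle γ μ ∂P :=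
  (ho.measurable_bestValue.stronglyMeasurable.integral_prod_left').measurable

/-- Lagrangian relaxation of the budget constraint. -/
theorem opt_le (ho : IsBestResponse oracle) {B : Fin m → ℝ} (hB : 0 ≤ B) {T : ℕ} (γ : Fin T → S)
    {μ : Fin m → ℝ} (hμ : μ ∈ orthant m) :
    opt B γ ≤ ∑ t, bestValue oracle (γ t) μ + μ ⬝ᵥ B := by
  refine csSup_le ⟨_, fun t => (γ t).1.void, ?_, rfl⟩ ?_
  · simpa only [Request.void, Request.consumption_zero, Finset.sum_const_zero] using hB
  · rintro _ ⟨x, hx, rfl⟩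
    have h1 : μ ⬝ᵥ ∑ t, (γ t).1.consumption (x t) ≤ μ ⬝ᵥ B :=
      Finset.sum_le_sum fun j _ => mul_le_mul_of_nonneg_left (hx j) (hμ j)
    have h2 := Finset.sum_le_sum fun t (_ : t ∈ Finset.univ) => ho.isMax (γ t) μ hμ (x t)
    rw [Finset.sum_sub_distrib, ← dotProduct_sum] at h2
    simp only [bestValue]
    linarith

end IsBestResponse

section Opt

variable {d m : ℕ} {S : Set (Request d m)}

theorem opt_nonneg (B : Fin m → ℝ) {T : ℕ} (γ : Fin T → S) : 0 ≤ opt B γ := by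
  refine Real.sSup_nonneg ?_
  rintro _ ⟨x, -, rfl⟩
  exact Finset.sum_nonneg fun t _ => (γ t).1.reward_nonneg _

theorem opt_le_mul {fbar : ℝ} (hfbar : 0 ≤ fbar) (hf : ∀ γ ∈ S, ∀ x, |γ.reward x| ≤ fbar)
    (B : Fin m → ℝ) {T : ℕ} (γ : Fin T → S) : opt B γ ≤ T * fbar := by
  refine Real.sSup_le ?_ (by positivity)
  rintro _ ⟨x, -, rfl⟩
  have := Finset.sum_le_sum fun t (_ : t ∈ (Finset.univ : Finset (Fin T))) =>
    (le_abs_self _).trans (hf (γ t).1 (γ t).2 (x t))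
  simpa using this

variable [MeasurableSpace S] {P : Measure S} [IsProbabilityMeasure P]

theorem integrable_opt {fbar : ℝ} (hfbar : 0 ≤ fbar) (hf : ∀ γ ∈ S, ∀ x, |γ.reward x| ≤ fbar)
    {B : Fin m → ℝ} {T : ℕ}
    (hopt : AEMeasurable (fun γ : Fin T → S => opt B γ) (Measure.pi fun _ => P)) :
    Integrable (fun γ : Fin T → S => opt B γ) (Measure.pi fun _ => P) :=
  Integrable.of_bound hopt.aestronglyMeasurable (T * fbar) <| Eventually.of_forall fun γ => by
    rw [Real.norm_eq_abs, abs_of_nonneg (opt_nonneg B γ)]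
    exact opt_le_mul hfbar hf B γ

theorem integral_opt_le {oracle : (γ : S) → (Fin m → ℝ) → γ.1.actions}
    (ho : IsBestResponse oracle)
    {fbar : ℝ} (hfbar : 0 ≤ fbar) (hf : ∀ γ ∈ S, ∀ x, |γ.reward x| ≤ fbar)
    {B : Fin m → ℝ} (hB : 0 ≤ B) {T : ℕ}
    (hopt : AEMeasurable (fun γ : Fin T → S => opt B γ) (Measure.pi fun _ => P))
    {μ : Fin m → ℝ} (hμ : μ ∈ orthant m) :
    ∫ γ : Fin T → S, opt B γ ∂(Measure.pi fun _ => P) ≤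
      T * ∫ γ, bestValue oracle γ μ ∂P + μ ⬝ᵥ B := by
  have hint := ho.integrable_bestValue hf P hμ
  have hi : ∀ t : Fin T, Integrable (fun γ : Fin T → S => bestValue oracle (γ t) μ)
      (Measure.pi fun _ => P) := fun t =>
    (measurePreserving_eval (fun _ => P) t).integrable_comp_of_integrable hint
  have hsum := integrable_finsetSum Finset.univ fun t (_ : t ∈ Finset.univ) => hi t
  refine (integral_mono (integrable_opt hfbar hf hopt) (hsum.add (integrable_const (μ ⬝ᵥ B)))
    fun γ => ho.opt_le hB γ hμ).trans (le_of_eq ?_)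
  rw [integral_add' hsum (integrable_const _), integral_finsetSum _ fun t _ => hi t]
  have he : ∀ t : Fin T, ∫ γ : Fin T → S, bestValue oracle (γ t) μ ∂(Measure.pi fun _ => P) =
      ∫ γ, bestValue oracle γ μ ∂P := fun t =>
    integral_comp_eval (μ := fun _ : Fin T => P) (i := t) hint.aestronglyMeasurable
  simp [he]

end Opt

/-! ### Independence of a request from the past -/

/-- A bounded function of the `t`-th coordinate and the coordinates before it integrates to `0`
if it does so in the `t`-th coordinate for every fixed past. -/
theorem integral_pi_coord_past_eq_zero {S : Type*} [MeasurableSpace S] (P : Measure S)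
    [IsProbabilityMeasure P] {T : ℕ} (t : Fin T) {G : S → (Fin t → S) → ℝ}
    (hG : Measurable (Function.uncurry G)) {C : ℝ} (hC : ∀ a δ, ‖G a δ‖ ≤ C)
    (h0 : ∀ δ, ∫ a, G a δ ∂P = 0) :
    ∫ γ : Fin T → S, G (γ t) (fun i => γ (Fin.castLE t.isLt.le i)) ∂(Measure.pi fun _ => P) = 0 := by
  obtain _ | n := T
  · exact t.elim0
  set past : (Fin n → S) → (Fin t → S) :=
    fun δ i => δ (Fin.castLE (Nat.lt_succ_iff.1 t.isLt) i) with hpast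
  have hpm : Measurable past := measurable_pi_lambda _ fun i => measurable_pi_apply _
  set f : S × (Fin n → S) → ℝ := fun q => G q.1 (past q.2) with hf
  have hfm : Measurable f := hG.comp (measurable_fst.prodMk (hpm.comp measurable_snd))
  have hcomp : ∀ γ : Fin (n + 1) → S, G (γ t) (fun i => γ (Fin.castLE t.isLt.le i)) =
      f (MeasurableEquiv.piFinSuccAbove (fun _ => S) t γ) := by
    intro γ
    refine congrArg (G (γ t)) (funext fun i => congrArg γ ?_)
    rw [Fin.succAbove_of_castSucc_lt]
    · rfl
    · exact i.isLt
  simp_rw [hcomp]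
  rw [(measurePreserving_piFinSuccAbove (fun _ => P) t).integral_comp' f,
    integral_prod_symm f (Integrable.of_bound hfm.aestronglyMeasurable C
      (Eventually.of_forall fun q => hC _ _))]
  simp only [hf, h0, integral_zero]

namespace AlgInput

variable {d m : ℕ} {S : Set (Request d m)} [MeasurableSpace S] (A : AlgInput S)

/-- While resources are ample, the conditional expectation of `max_x {f(x) - μ_tᵀ b(x)}` given the
past, minus its realization; `0` afterwards. -/
noncomputable def noise (bbar : ℝ) (P : Measure S) (s : AlgState m) (γ : S) : ℝ :=
  open Classical in
  if s.Ample bbar then ∫ a, bestValue A.oracle a s.dual ∂P - bestValue A.oracle γ s.dual else 0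

/-- The reward collected in a period, corrected by the noise, is at least the credit. -/
theorem credit_le_reward_add_noise {bbar : ℝ}
    (hb : ∀ γ ∈ S, ∀ x j, |γ.consumption x j| ≤ bbar) (P : Measure S) (s : AlgState m) (γ : S) :
    A.credit bbar (fun μ => ∫ a, bestValue A.oracle a μ ∂P) s γ ≤
      γ.1.reward (A.action s γ) + A.noise bbar P s γ := by
  unfold credit noise
  split_ifs with hs
  · rw [A.action_eq_oracle_of_ample hb hs]
    simp only [bestValue]
    linarith
  · simpa using γ.1.reward_nonneg _

variable {P : Measure S} [IsProbabilityMeasure P]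

theorem norm_noise_le (hA : IsBestResponse A.oracle) {fbar bbar : ℝ} (hfbar : 0 ≤ fbar)
    (hf : ∀ γ ∈ S, ∀ x, |γ.reward x| ≤ fbar) {s : AlgState m} (hs : s.dual ∈ orthant m) (γ : S) :
    ‖A.noise bbar P s γ‖ ≤ fbar + fbar := by
  unfold noise
  split_ifs
  · refine (norm_sub_le _ _).trans (add_le_add ?_ (hA.norm_bestValue_le hf γ hs))
    refine (norm_integral_le_of_norm_le_const
      (Eventually.of_forall fun a => hA.norm_bestValue_le hf a hs)).trans_eq ?_
    simp
  · simpa using hfbar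

theorem integral_noise (hA : IsBestResponse A.oracle) {fbar bbar : ℝ}
    (hf : ∀ γ ∈ S, ∀ x, |γ.reward x| ≤ fbar) {s : AlgState m} (hs : s.dual ∈ orthant m) :
    ∫ γ, A.noise bbar P s γ ∂P = 0 := by
  unfold noise
  split_ifs
  · rw [integral_sub (integrable_const _) (hA.integrable_bestValue hf P hs)]
    simp
  · simp

theorem measurable_noise (hA : IsBestResponse A.oracle) (bbar : ℝ) {Ω : Type*} [MeasurableSpace Ω]
    {X : Ω → S} {s : Ω → AlgState m} (hX : Measurable X)
    (hs : Measurable fun ω => (s ω).dual) (ho : ∀ ω, (s ω).dual ∈ orthant m)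
    (hr : Measurable fun ω => (s ω).remaining) :
    Measurable fun ω => A.noise bbar P (s ω) (X ω) := by
  have hset : MeasurableSet {ω | (s ω).Ample bbar} :=
    measurableSet_le (measurable_const (a := fun _ : Fin m => bbar)) hr
  have hdual := hs.subtype_mk (h := ho)
  exact Measurable.ite hset (((hA.measurable_integral_bestValue P).comp hdual).sub
    (hA.measurable_bestValue.comp (hX.prodMk hdual))) measurable_const

section Paths

variable {σ fbar bbar : ℝ}

theorem measurable_stateAt (hσ : 0 < σ) (hh : IsReferenceFunction A.refFun σ)
    (hη : 0 < A.stepSize) (h₁ : A.initDual ∈ smoothPoints A.refFun)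
    (hA : IsBestResponse A.oracle) {T : ℕ} (t : Fin T) :
    Measurable (fun γ : Fin T → S => (A.stateAt γ t).dual) ∧
      Measurable (fun γ : Fin T → S => (A.stateAt γ t).remaining) := by
  have hpast : Measurable fun (γ : Fin T → S) (i : Fin t) => γ (Fin.castLE t.isLt.le i) :=
    measurable_pi_lambda _ fun i => measurable_pi_apply _
  have h := A.measurable_state hσ hh hη h₁ hA t
  exact ⟨h.1.comp hpast, h.2.comp hpast⟩

theorem integrable_noise_stateAt (hσ : 0 < σ) (hh : IsReferenceFunction A.refFun σ)
    (hη : 0 < A.stepSize) (h₁ : A.initDual ∈ smoothPoints A.refFun)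
    (hA : IsBestResponse A.oracle) (hfbar : 0 ≤ fbar)
    (hf : ∀ γ ∈ S, ∀ x, |γ.reward x| ≤ fbar) {T : ℕ} (t : Fin T) :
    Integrable (fun γ : Fin T → S => A.noise bbar P (A.stateAt γ t) (γ t))
      (Measure.pi fun _ => P) := by
  obtain ⟨hd, hr⟩ := A.measurable_stateAt hσ hh hη h₁ hA t
  have ho : ∀ γ : Fin T → S, (A.stateAt γ t).dual ∈ orthant m :=
    fun γ => (A.dual_state_mem hσ hh hη h₁ t _).1
  exact Integrable.of_bound
    (A.measurable_noise hA bbar (measurable_pi_apply t) hd ho hr).aestronglyMeasurable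
    (fbar + fbar) (Eventually.of_forall fun γ => A.norm_noise_le hA hfbar hf (ho γ) _)

theorem integral_noise_stateAt (hσ : 0 < σ) (hh : IsReferenceFunction A.refFun σ)
    (hη : 0 < A.stepSize) (h₁ : A.initDual ∈ smoothPoints A.refFun)
    (hA : IsBestResponse A.oracle) (hfbar : 0 ≤ fbar)
    (hf : ∀ γ ∈ S, ∀ x, |γ.reward x| ≤ fbar) {T : ℕ} (t : Fin T) :
    ∫ γ : Fin T → S, A.noise bbar P (A.stateAt γ t) (γ t) ∂(Measure.pi fun _ => P) = 0 := by
  obtain ⟨hd, hr⟩ := A.measurable_state hσ hh hη h₁ hA t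
  have ho : ∀ δ : Fin t → S, (A.state t δ).dual ∈ orthant m :=
    fun δ => (A.dual_state_mem hσ hh hη h₁ t δ).1
  refine integral_pi_coord_past_eq_zero P t (G := fun a δ => A.noise bbar P (A.state t δ) a)
    ?_ (fun a δ => A.norm_noise_le hA hfbar hf (ho δ) a) fun δ => A.integral_noise hA hf (ho δ)
  exact A.measurable_noise hA bbar (s := fun q : S × (Fin t → S) => A.state t q.2)
    measurable_fst (hd.comp measurable_snd) (fun q => ho q.2) (hr.comp measurable_snd)

theorem integrable_totalReward (hσ : 0 < σ) (hh : IsReferenceFunction A.refFun σ)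
    (hη : 0 < A.stepSize) (h₁ : A.initDual ∈ smoothPoints A.refFun)
    (hA : IsBestResponse A.oracle) (hvoid : Measurable fun γ : S => γ.1.reward γ.1.void)
    (hf : ∀ γ ∈ S, ∀ x, |γ.reward x| ≤ fbar) (T : ℕ) :
    Integrable (fun γ : Fin T → S => A.totalReward γ) (Measure.pi fun _ => P) := by
  refine integrable_finsetSum _ fun t _ => ?_
  obtain ⟨hd, hr⟩ := A.measurable_stateAt hσ hh hη h₁ hA t
  exact Integrable.of_bound (A.measurable_action_reward hA hvoid (measurable_pi_apply t) hd
    (fun γ => (A.dual_state_mem hσ hh hη h₁ t _).1) hr).aestronglyMeasurable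
    fbar (Eventually.of_forall fun γ => hf _ (γ t).2 _)

end Paths

end AlgInput

/-! ### The guarantee in expectation -/

theorem rhoMin_pos {m : ℕ} (hm : 0 < m) {B : Fin m → ℝ} (hB : ∀ j, 0 < B j) {T : ℕ}
    (hT : 1 ≤ T) : 0 < rhoMin B T := by
  have : Nonempty (Fin m) := ⟨⟨0, hm⟩⟩
  obtain ⟨j, hj⟩ := exists_eq_ciInf_of_finite (f := fun j => rho B T j)
  rw [rhoMin, ← hj]
  have : (0 : ℝ) < T := by exact_mod_cast hT
  exact div_pos (hB j) this

theorem rhoMin_le {m : ℕ} (B : Fin m → ℝ) (T : ℕ) (j : Fin m) : rhoMin B T ≤ rho B T j :=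
  ciInf_le (Set.finite_range _).bddBelow j

theorem le_targetMax {m N : ℕ} (lam : ℕ → Fin m → ℝ) {t : ℕ} (ht : t < N) (j : Fin m) :
    lam t j ≤ targetMax N lam :=
  (le_ciSup (f := fun j => lam t j) (Set.finite_range _).bddAbove j).trans
    (le_ciSup (f := fun t : Fin N => ⨆ j, lam t j) (Set.finite_range _).bddAbove ⟨t, ht⟩)

end HorizonAlloc

theorem mainTheorem2 {d m : ℕ} (hm : 0 < m)
    -- the requests, their distribution and the uniform bounds
    (S : Set (Request d m)) [MeasurableSpace S] (P : Measure S) [IsProbabilityMeasure P]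
    (fbar bbar : ℝ) (hfbar : 0 ≤ fbar) (hbbar : 0 ≤ bbar)
    (hf : ∀ γ ∈ S, ∀ x, |γ.reward x| ≤ fbar)
    (hb : ∀ γ ∈ S, ∀ x j, |γ.consumption x j| ≤ bbar)
    -- the initial budget
    (B : Fin m → ℝ) (hBpos : ∀ j, 0 < B j) (hB : ∀ j, 2 * bbar ≤ B j)
    -- the target consumption sequence (of length `N`) and the horizon
    (N : ℕ) (lam : ℕ → Fin m → ℝ) (hlam : IsTargetSequence B N lam)
    (T : ℕ) (hT : 1 ≤ T) (hTN : T ≤ N)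
    -- the reference function, step size and initial dual variable
    (h : (Fin m → ℝ) → ℝ) (σ : ℝ) (hσ : 0 < σ) (hh : IsReferenceFunction h σ)
    (η : ℝ) (hη : 0 < η)
    (μ₁ : Fin m → ℝ) (hμ₁ : μ₁ ∈ orthant m)
    (hμ₁' : DifferentiableWithinAt ℝ h (orthant m) μ₁)
    -- the choice of price-adjusted maximizers and of the action in the subgradient
    (oracle : (γ : S) → (Fin m → ℝ) → γ.1.actions) (horacle : IsBestResponse oracle)
    (rule : GradientRule)
    (hvoid : Measurable fun γ : S => γ.1.reward γ.1.void)
    (hopt : AEMeasurable (fun γ : Fin T → S => opt B γ) (Measure.pi fun _ => P)) :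
    let A : AlgInput S := ⟨B, lam, h, η, μ₁, oracle, rule⟩
    Integrable (fun γ : Fin T → S => targetRatio B lam T * opt B γ - A.totalReward γ)
        (Measure.pi fun _ => P) ∧
      ∫ γ : Fin T → S, (targetRatio B lam T * opt B γ - A.totalReward γ) ∂(Measure.pi fun _ => P) ≤
        fbar * bbar / rhoMin B T
          + (bbar + targetMax N lam) ^ 2 / (2 * σ) * η * T
          + (1 / η) * max (bregman h 0 μ₁)
              (⨆ j : Fin m, bregman h (Pi.single j (fbar / rhoMin B T)) μ₁) := by
  intro A
  have h₁ : A.initDual ∈ smoothPoints A.refFun := ⟨hμ₁, hμ₁'⟩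
  have hRint := A.integrable_totalReward (P := P) hσ hh hη h₁ horacle hvoid hf T
  have hOint := (integrable_opt hfbar hf hopt).const_mul (targetRatio B lam T)
  have hint := hOint.sub hRint
  refine ⟨hint, ?_⟩
  have : Nonempty (Fin m) := ⟨⟨0, hm⟩⟩
  have hT0 : (0 : ℝ) < T := by exact_mod_cast hT
  have hρ := rhoMin_pos hm hBpos hT
  have hρj : ∀ j, 0 < rho B T j := fun j => hρ.trans_le (rhoMin_le B T j)
  set F : (Fin m → ℝ) → ℝ := fun μ => ∫ a, bestValue oracle a μ ∂P with hF
  have hF0 : ∀ μ ∈ orthant m, 0 ≤ F μ := fun μ hμ =>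
    integral_nonneg fun a => horacle.bestValue_nonneg a hμ
  set O : ℝ := (∫ γ : Fin T → S, opt B γ ∂(Measure.pi fun _ => P)) / T with hO
  have hO0 : 0 ≤ O := div_nonneg (integral_nonneg fun γ => opt_nonneg B γ) hT0.le
  have hOf : O ≤ fbar := by
    rw [hO, div_le_iff₀' hT0]
    refine (integral_mono (integrable_opt hfbar hf hopt) (integrable_const (T * fbar))
      fun γ => opt_le_mul hfbar hf B γ).trans_eq ?_
    simp
  have hOdual : ∀ μ ∈ orthant m, O ≤ F μ + ∑ j, μ j * rho B T j := by
    intro μ hμ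
    have h2 := integral_opt_le horacle hfbar hf (fun j => (hBpos j).le) hopt hμ
    rw [hO, div_le_iff₀ hT0]
    refine h2.trans_eq ?_
    have h3 : ∀ j, μ j * rho B T j * T = μ j * B j := fun j => by
      rw [rho]; field_simp
    rw [add_mul, Finset.sum_mul, Finset.sum_congr rfl fun j _ => h3 j, mul_comm]
    rfl
  set c : ℕ → ℝ := fun t => min (⨅ j, lam t j / rho B T j) 1 with hc
  have hc0 : ∀ t < N, 0 ≤ c t := fun t ht => le_min
    (le_ciInf fun j => div_nonneg (hlam.nonneg t ht j) (hρj j).le) zero_le_one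
  have hc1 : ∀ t, c t ≤ 1 := fun t => min_le_right _ _
  have hcρ : ∀ t j, c t * rho B T j ≤ lam t j := fun t j => by
    rw [← le_div_iff₀ (hρj j)]
    exact (min_le_left _ _).trans (ciInf_le (Set.finite_range _).bddBelow j)
  have hFa : ∀ t < N, ∀ μ ∈ orthant m, c t * O ≤ F μ + μ ⬝ᵥ lam t := by
    intro t ht μ hμ
    have h2 := mul_le_mul_of_nonneg_left (hOdual μ hμ) (hc0 t ht)
    have h3 : c t * F μ ≤ F μ := mul_le_of_le_one_left (hF0 μ hμ) (hc1 t)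
    have h4 : c t * ∑ j, μ j * rho B T j ≤ μ ⬝ᵥ lam t := by
      rw [Finset.mul_sum]
      refine Finset.sum_le_sum fun j _ => ?_
      rw [mul_left_comm]
      exact mul_le_mul_of_nonneg_left (hcρ t j) (hμ j)
    linarith
  have hκ : 0 ≤ fbar / rhoMin B T := div_nonneg hfbar hρ.le
  have hκa : ∀ t < N, ∀ j, c t * O ≤ fbar / rhoMin B T * lam t j := by
    intro t ht j
    have h2 : c t * rhoMin B T ≤ lam t j :=
      (mul_le_mul_of_nonneg_left (rhoMin_le B T j) (hc0 t ht)).trans (hcρ t j)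
    calc c t * O ≤ c t * fbar := mul_le_mul_of_nonneg_left hOf (hc0 t ht)
      _ = fbar / rhoMin B T * (c t * rhoMin B T) := by field_simp
      _ ≤ _ := mul_le_mul_of_nonneg_left h2 hκ
  have hM : ∀ n < N, ∀ s γ j,
      |(A.target n - A.gradientConsumption s γ) j| ≤ bbar + targetMax N lam :=
    fun n hn => A.abs_target_sub_gradientConsumption_le hb (hlam.nonneg n hn)
      (le_targetMax lam hn)
  -- `κ = f̄ / ρ_min` turns what remains of the target of an exhausted resource into the reward
  -- that the remaining periods may forfeit
  have hpath := fun γ : Fin T → S =>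
    A.credit_ge hσ hh hη h₁ hbbar hb hM hF0 hFa hκ hκa hlam hTN γ
  have hsum : ∑ t ∈ Finset.range T, c t * O =
      targetRatio B lam T * ∫ γ : Fin T → S, opt B γ ∂(Measure.pi fun _ => P) := by
    rw [← Finset.sum_mul, hO, targetRatio]
    ring
  set Bd : ℝ := fbar / rhoMin B T * bbar + T * (η * (bbar + targetMax N lam) ^ 2 / (2 * σ)) +
    (1 / η) * max (bregman h 0 μ₁)
      (⨆ j : Fin m, bregman h (Pi.single j (fbar / rhoMin B T)) μ₁) with hBd
  have hnoise := fun t : Fin T =>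
    A.integrable_noise_stateAt (P := P) (bbar := bbar) hσ hh hη h₁ horacle hfbar hf t
  have hNint := integrable_finsetSum Finset.univ fun t (_ : t ∈ Finset.univ) => hnoise t
  have hN0 : ∫ γ : Fin T → S, (∑ t, A.noise bbar P (A.stateAt γ t) (γ t))
      ∂(Measure.pi fun _ => P) = 0 := by
    rw [integral_finsetSum _ fun t _ => hnoise t]
    exact Finset.sum_eq_zero fun t _ =>
      A.integral_noise_stateAt hσ hh hη h₁ horacle hfbar hf t
  have hlow : ∀ γ : Fin T → S, ∑ t ∈ Finset.range T, c t * O - Bd ≤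
      A.totalReward γ + ∑ t, A.noise bbar P (A.stateAt γ t) (γ t) := by
    intro γ
    have h2 := Finset.sum_le_sum fun t (_ : t ∈ Finset.univ) =>
      A.credit_le_reward_add_noise hb P (A.stateAt γ t) (γ t)
    rw [Finset.sum_add_distrib] at h2
    have h3 := (hpath γ).trans h2
    rw [AlgInput.totalReward]
    refine le_trans (le_of_eq ?_) h3
    rw [hBd]
    ring
  have hER : ∑ t ∈ Finset.range T, c t * O - Bd ≤
      ∫ γ : Fin T → S, A.totalReward γ ∂(Measure.pi fun _ => P) := by
    have h2 := integral_mono (integrable_const _) (hRint.add hNint) hlow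
    rw [integral_add' hRint hNint, hN0, add_zero] at h2
    simpa using h2
  rw [integral_sub hOint hRint, integral_const_mul, ← hsum]
  refine (sub_le_comm.1 hER).trans (le_of_eq ?_)
  rw [hBd]
  ring
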